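/- Let $\alpha,\beta\in\mathbb{R}$ be such that $0,\alpha,\beta$ are pairwise distinct, and let $$\Lambda=\{(0,0),(\alpha,0),(\beta,0),(0,1)\}\subset\mathbb{R}^2 .$$ For $f\in L^2(\mathbb{R})$ (complex-valued) and $(a,b)\in\mathbb{R}^2$ put $M_bT_af(x)=e^{2\pi i bx}f(x-a)$, and for $x\in\mathbb{R}$ let $\|x\|$ denote the distance from $x$ to the nearest integer. Suppose that at least one of the following holds: (a) $\displaystyle\liminf_{n\to\infty}\, n\ln n\,\min\Big\{\Big\|n\frac{\beta}{\alpha}\Big\|,\Big\|n\frac{\alpha}{\beta}\Big\|\Big\}<\infty$, where $n$ runs through the positive integers; (b) at least one of $\alpha,\beta$ is rational. Then the HRT (Heil–Ramanathan–Topiwala) conjecture holds for $\Lambda$: for every nonzero $f\in L^2(\mathbb{R})$, the Gabor system $\mathcal{G}(f,\Lambda)=\{M_bT_af:(a,b)\in\Lambda\}$, indexed by the four points of $\Lambda$, is linearly independent over $\mathbb{C}$ in $L^2(\mathbb{R})$. -/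

import Mathlib

open MeasureTheory Filter

noncomputable section

namespace HRT

/-- The distance from a real number `x` to the nearest integer, usually written `‖x‖`. -/
def distInt (x : ℝ) : ℝ := |x - round x|

/-- The time-frequency translate `M_b T_a f` of a function `f : ℝ → ℂ`, for `p = (a, b)`:
`(M_b T_a f)(x) = exp(2 π i b x) f(x - a)`. -/
def timeFreqTranslate (p : ℝ × ℝ) (f : ℝ → ℂ) : ℝ → ℂ :=
  fun x => Complex.exp (2 * Real.pi * Complex.I * p.2 * x) * f (x - p.1)

/-- Time-frequency translates of square integrable functions are square integrable. -/
theorem memLp_timeFreqTranslate (p : ℝ × ℝ) {f : ℝ → ℂ} (hf : MemLp f 2 volume) :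
    MemLp (timeFreqTranslate p f) 2 volume := by
  have h1 : MemLp (fun x => f (x - p.1)) 2 volume :=
    hf.comp_measurePreserving (measurePreserving_sub_right volume p.1)
  refine h1.of_le ?_ (ae_of_all _ fun x => ?_)
  · refine AEStronglyMeasurable.mul (Continuous.aestronglyMeasurable ?_) h1.1
    fun_prop
  · have h2 : (2 * Real.pi * Complex.I * p.2 * x : ℂ)
        = ((2 * Real.pi * p.2 * x : ℝ) : ℂ) * Complex.I := by
      push_cast; ring
    rw [timeFreqTranslate, norm_mul, h2, Complex.norm_exp_ofReal_mul_I, one_mul]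

/-- The time-frequency translate of an element of `L²(ℝ)`, as an element of `L²(ℝ)`. -/
def timeFreqShift (p : ℝ × ℝ) (f : Lp ℂ 2 (volume : Measure ℝ)) :
    Lp ℂ 2 (volume : Measure ℝ) :=
  (memLp_timeFreqTranslate p (Lp.memLp f)).toLp (timeFreqTranslate p f)

/-- The HRT conjecture holds for `Λ ⊆ ℝ²`: for every nonzero `f ∈ L²(ℝ)`, the Gabor system
`(M_b T_a f)`, indexed by the points `(a, b)` of `Λ`, is linearly independent over `ℂ`
in `L²(ℝ)`. -/
def HoldsFor (Λ : Set (ℝ × ℝ)) : Prop :=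
  ∀ f : Lp ℂ 2 (volume : Measure ℝ), f ≠ 0 →
    LinearIndependent ℂ (fun p : Λ => timeFreqShift (p : ℝ × ℝ) f)

/-- The special configuration `{(0,0), (α,0), (β,0), (0,1)}`. -/
def config (α β : ℝ) : Set (ℝ × ℝ) := {(0, 0), (α, 0), (β, 0), (0, 1)}

end HRT

end

/-!
Suppose that `f` and its translates `T_α f`, `T_β f`, `M_1 f` are linearly dependent. The Fourier
transform `g` of `f` then satisfies, after scaling and unless only translations occur, `g (ξ - 1) =
P ξ * g ξ` for a trigonometric polynomial `P` with the three frequencies `0, α, β`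
(`ae_recurrence_of_dependence`), so `G = |g|` is a square integrable solution of `G (ξ - 1) = |P ξ|
* G ξ`. It has to be shown that `G` vanishes. (If only translations occur, then `P g = 0` and `P`
has a null zero set.)

If `T` is close to an integer `N` and an approximate almost period of `|P|`, the products of `|P|`
over the stretches `ξ, ξ - 1, …, ξ - N + 1` and over their translates by `T` nearly agree. The first
product is `G (ξ - N) / G ξ`, the second one is `G (ξ + T - N) / G (ξ + T)`. Since `G` is square
integrable, `G (ξ - N)` and `G (ξ + T)` are small for most `ξ`, whereas `G ξ` and `G (ξ + T - N)`
are both bounded below on a set of positive measure, as `T - N` is a small translation. This is a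
contradiction as soon as the ratio of the two products stays bounded, for which it suffices to bound
`∫ log (1 + δ / |P|)` over intervals of length `N`, where `δ` is the error of almost periodicity
(`ae_eq_zero_of_almost_periodic`).

For the Diophantine condition, `T` is a bounded multiple of `n / α`, chosen close to an integer,
with `n` the denominator of a rational approximation of `β / α` in lowest terms, and `δ` is of order
`1 / (n log n)`. The integral is bounded for two different reasons (`exists_lintegral_log_le`). If
`P` and `P'` have no common approximate zero, then `|P|` is locally at least a multiple of the
distance to a point, and each unit of length contributes `O(1 / n)`. Otherwise the moduli of the
coefficients are in the proportions `|β - α| : |β| : |α|`, and near each `ξ` with `αξ + θ` equal to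
an integer `a` the polynomial is bounded below, up to constants, by the square of the distance to
this point and by the distance of `(β / α) a + κ` to the integers; the latter distances are spaced
by `1 / n`, so that a harmonic sum results.

If `α` is rational with denominator `q`, then `A + B exp(2πiαξ)` takes finitely many values along an
orbit `ξ - k`, almost surely none of modulus `|C|`, so `|P|` is bounded below along the orbit. Then
`T = q N`, with `N` supplied by Dirichlet's theorem for `q β`, gives the contradiction pointwise
(`onlyZeroSolution_trig_of_rational_of_ne_zero`). In the remaining cases `|P|` is periodic.
-/

noncomputable section

open scoped FourierTransform

namespace HRT

/-! ### Time-frequency shifts and the Fourier transform on `L²(ℝ)` -/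

theorem coeFn_timeFreqShift (p : ℝ × ℝ) (f : Lp ℂ 2 (volume : Measure ℝ)) :
    timeFreqShift p f =ᵐ[volume] timeFreqTranslate p f :=
  MemLp.coeFn_toLp _

theorem norm_exp_two_pi_I_mul (x : ℝ) : ‖Complex.exp (2 * Real.pi * Complex.I * x)‖ = 1 := by
  have h : (2 * Real.pi * Complex.I * x : ℂ) = ((2 * Real.pi * x : ℝ) : ℂ) * Complex.I := by
    push_cast; ring
  rw [h, Complex.norm_exp_ofReal_mul_I]

theorem norm_timeFreqTranslate (p : ℝ × ℝ) (f : ℝ → ℂ) (x : ℝ) :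
    ‖timeFreqTranslate p f x‖ = ‖f (x - p.1)‖ := by
  have h := norm_exp_two_pi_I_mul (p.2 * x)
  push_cast at h
  rw [timeFreqTranslate, norm_mul, mul_assoc _ (p.2 : ℂ), h, one_mul]

theorem quasiMeasurePreserving_sub_right (a : ℝ) :
    Measure.QuasiMeasurePreserving (fun x : ℝ => x - a) volume volume :=
  (measurePreserving_sub_right volume a).quasiMeasurePreserving

theorem isometry_timeFreqShift (p : ℝ × ℝ) : Isometry (timeFreqShift p) := by
  refine Isometry.of_dist_eq fun f g => ?_
  have h : timeFreqShift p f - timeFreqShift p g = timeFreqShift p (f - g) := by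
    apply Lp.ext
    have hc := (quasiMeasurePreserving_sub_right p.1).ae (Lp.coeFn_sub f g)
    filter_upwards [Lp.coeFn_sub (timeFreqShift p f) (timeFreqShift p g), coeFn_timeFreqShift p f,
      coeFn_timeFreqShift p g, coeFn_timeFreqShift p (f - g), hc] with x h1 h2 h3 h4 h5
    rw [h1, Pi.sub_apply, h2, h3, h4]
    simp only [timeFreqTranslate] at *
    rw [h5, Pi.sub_apply, mul_sub]
  rw [dist_eq_norm, dist_eq_norm, h, Lp.norm_def, Lp.norm_def,
    eLpNorm_congr_ae (coeFn_timeFreqShift p (f - g)),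
    eLpNorm_congr_norm_ae (ae_of_all _ fun x => norm_timeFreqTranslate p _ x)]
  congr 1
  exact eLpNorm_comp_measurePreserving (Lp.aestronglyMeasurable _)
    (measurePreserving_sub_right volume p.1)

theorem fourier_compSubConst (a : ℝ) (φ : SchwartzMap ℝ ℂ) (ξ : ℝ) :
    (𝓕 (φ.compSubConstCLM ℂ a) : SchwartzMap ℝ ℂ) ξ =
      timeFreqTranslate (0, -a) (𝓕 φ : SchwartzMap ℝ ℂ) ξ := by
  rw [timeFreqTranslate, sub_zero, SchwartzMap.fourier_coe, SchwartzMap.fourier_coe,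
    Real.fourier_real_eq_integral_exp_smul, Real.fourier_real_eq_integral_exp_smul,
    ← integral_const_mul, ← integral_add_right_eq_self _ a]
  congr 1; ext x
  simp only [SchwartzMap.compSubConstCLM_apply, smul_eq_mul, add_sub_cancel_right]
  rw [← mul_assoc, ← Complex.exp_add]
  congr 2
  push_cast; ring

theorem fourierInv_compSubConst (a : ℝ) (φ : SchwartzMap ℝ ℂ) (x : ℝ) :
    (𝓕⁻ (φ.compSubConstCLM ℂ a) : SchwartzMap ℝ ℂ) x =
      timeFreqTranslate (0, a) (𝓕⁻ φ : SchwartzMap ℝ ℂ) x := by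
  rw [timeFreqTranslate, sub_zero, SchwartzMap.fourierInv_coe, SchwartzMap.fourierInv_coe,
    Real.fourierInv_eq_fourier_neg, Real.fourierInv_eq_fourier_neg, ← SchwartzMap.fourier_coe,
    ← SchwartzMap.fourier_coe, fourier_compSubConst, timeFreqTranslate, sub_zero]
  congr 2
  push_cast; ring

theorem timeFreqShift_toLp (p : ℝ × ℝ) (φ ψ : SchwartzMap ℝ ℂ)
    (h : ∀ x, ψ x = timeFreqTranslate p φ x) :
    timeFreqShift p (φ.toLp 2 volume) = ψ.toLp 2 volume := by
  apply Lp.ext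
  have hc := (quasiMeasurePreserving_sub_right p.1).ae (φ.coeFn_toLp 2 volume)
  filter_upwards [coeFn_timeFreqShift p (φ.toLp 2 volume), ψ.coeFn_toLp 2 volume, hc] with x h1 h2 h3
  rw [h1, h2, h, timeFreqTranslate, timeFreqTranslate, h3]

/-- The Fourier transform turns the translation by `a` into the modulation by `-a`. -/
theorem fourier_translate (a : ℝ) (f : Lp ℂ 2 (volume : Measure ℝ)) :
    𝓕 (timeFreqShift (a, 0) f) = timeFreqShift (0, -a) (𝓕 f) := by
  refine DenseRange.induction_on (SchwartzMap.denseRange_toLpCLM (p := 2) (μ := volume)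
    ENNReal.ofNat_ne_top) f (isClosed_eq ?_ ?_) fun φ => ?_
  · exact (Lp.fourierTransformₗᵢ ℝ ℂ).continuous.comp (isometry_timeFreqShift _).continuous
  · exact (isometry_timeFreqShift _).continuous.comp (Lp.fourierTransformₗᵢ ℝ ℂ).continuous
  · rw [SchwartzMap.toLpCLM_apply, SchwartzMap.toLp_fourier_eq,
      timeFreqShift_toLp (a, 0) φ (φ.compSubConstCLM ℂ a) fun x => by simp [timeFreqTranslate],
      SchwartzMap.toLp_fourier_eq, timeFreqShift_toLp (0, -a) (𝓕 φ) _ (fourier_compSubConst a φ)]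

theorem fourierInv_translate (a : ℝ) (f : Lp ℂ 2 (volume : Measure ℝ)) :
    𝓕⁻ (timeFreqShift (a, 0) f) = timeFreqShift (0, a) (𝓕⁻ f) := by
  refine DenseRange.induction_on (SchwartzMap.denseRange_toLpCLM (p := 2) (μ := volume)
    ENNReal.ofNat_ne_top) f (isClosed_eq ?_ ?_) fun φ => ?_
  · exact (Lp.fourierTransformₗᵢ ℝ ℂ).symm.continuous.comp (isometry_timeFreqShift _).continuous
  · exact (isometry_timeFreqShift _).continuous.comp (Lp.fourierTransformₗᵢ ℝ ℂ).symm.continuous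
  · rw [SchwartzMap.toLpCLM_apply, SchwartzMap.toLp_fourierInv_eq,
      timeFreqShift_toLp (a, 0) φ (φ.compSubConstCLM ℂ a) fun x => by simp [timeFreqTranslate],
      SchwartzMap.toLp_fourierInv_eq,
      timeFreqShift_toLp (0, a) (𝓕⁻ φ) _ (fourierInv_compSubConst a φ)]

/-- The Fourier transform turns the modulation by `b` into the translation by `b`. -/
theorem fourier_modulate (b : ℝ) (f : Lp ℂ 2 (volume : Measure ℝ)) :
    𝓕 (timeFreqShift (0, b) f) = timeFreqShift (b, 0) (𝓕 f) := by
  have h := fourierInv_translate b (𝓕 f)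
  rw [FourierTransform.fourierInv_fourier_eq] at h
  rw [← h, FourierTransform.fourier_fourierInv_eq]

/-! ### Characters and trigonometric polynomials with three frequencies -/

/-- The character `x ↦ exp(2πix)` of the real line. -/
def expTurn (x : ℝ) : ℂ := Complex.exp (2 * Real.pi * Complex.I * x)

/-- The trigonometric polynomial `A + B exp(2πiαξ) + C exp(2πiβξ)`. -/
def trig (A B C : ℂ) (α β ξ : ℝ) : ℂ := A + B * expTurn (α * ξ) + C * expTurn (β * ξ)

theorem norm_expTurn (x : ℝ) : ‖expTurn x‖ = 1 := norm_exp_two_pi_I_mul x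

theorem expTurn_add (x y : ℝ) : expTurn (x + y) = expTurn x * expTurn y := by
  rw [expTurn, expTurn, expTurn, ← Complex.exp_add]; congr 1; push_cast; ring

theorem expTurn_zero : expTurn 0 = 1 := by simp [expTurn]

theorem expTurn_int (n : ℤ) : expTurn n = 1 := by
  rw [expTurn, ← Complex.exp_int_mul_two_pi_mul_I n]; congr 1; push_cast; ring

theorem expTurn_sub_int (x : ℝ) (n : ℤ) : expTurn (x - n) = expTurn x := by
  rw [← mul_one (expTurn (x - n)), ← expTurn_int n, ← expTurn_add, sub_add_cancel]

theorem conj_expTurn (x : ℝ) : (starRingEnd ℂ) (expTurn x) = expTurn (-x) := by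
  rw [expTurn, expTurn, ← Complex.exp_conj]
  congr 1
  simp [Complex.conj_ofNat]

theorem expTurn_neg_mul (x : ℝ) : expTurn (-x) * expTurn x = 1 := by
  rw [← expTurn_add, neg_add_cancel, expTurn_zero]

theorem norm_expTurn_sub_one_le (x : ℝ) : ‖expTurn x - 1‖ ≤ 2 * Real.pi * |x| := by
  have h := Real.norm_exp_I_mul_ofReal_sub_one_le (x := 2 * Real.pi * x)
  have h2 : expTurn x = Complex.exp (Complex.I * ((2 * Real.pi * x : ℝ) : ℂ)) := by
    rw [expTurn]; congr 1; push_cast; ring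
  rw [h2]
  refine h.trans (le_of_eq ?_)
  rw [Real.norm_eq_abs, abs_mul, abs_of_pos Real.two_pi_pos]

theorem norm_expTurn_sub_one_le_distInt (x : ℝ) : ‖expTurn x - 1‖ ≤ 2 * Real.pi * distInt x := by
  rw [← expTurn_sub_int x (round x)]
  exact norm_expTurn_sub_one_le _

/-- Jordan's inequality for the chord `|exp(2πix) - 1| = 2|sin πx|`. -/
theorem four_mul_abs_le_norm_expTurn_sub_one {x : ℝ} (hx : |x| ≤ 1 / 2) :
    4 * |x| ≤ ‖expTurn x - 1‖ := by
  have h2 : expTurn x = Complex.exp (Complex.I * ((2 * Real.pi * x : ℝ) : ℂ)) := by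
    rw [expTurn]; congr 1; push_cast; ring
  have hp := Real.pi_pos
  rw [h2, Complex.norm_exp_I_mul_ofReal_sub_one, norm_mul, Real.norm_eq_abs, Real.norm_eq_abs,
    abs_of_pos (by norm_num : (0 : ℝ) < 2)]
  have h3 := Real.mul_abs_le_abs_sin (x := 2 * Real.pi * x / 2) (by
    rw [show 2 * Real.pi * x / 2 = Real.pi * x by ring, abs_mul, abs_of_pos hp]; nlinarith)
  have h4 : 2 / Real.pi * |2 * Real.pi * x / 2| = 2 * |x| := by
    rw [show 2 * Real.pi * x / 2 = Real.pi * x by ring, abs_mul, abs_of_pos hp]; field_simp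
  linarith

theorem norm_expTurn_sub_one_sub_le (x : ℝ) :
    ‖expTurn x - 1 - 2 * Real.pi * Complex.I * x‖ ≤ 2 * (2 * Real.pi * x) ^ 2 := by
  have hn : ‖(2 * Real.pi * Complex.I * x : ℂ)‖ = |2 * Real.pi * x| := by
    simp [abs_mul, abs_of_pos Real.pi_pos]
  rw [← sq_abs]
  rcases le_total |2 * Real.pi * x| 1 with h | h
  · have h1 := Complex.norm_exp_sub_one_sub_id_le (x := (2 * Real.pi * Complex.I * x : ℂ))
      (by rw [hn]; exact h)
    rw [hn] at h1
    rw [expTurn]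
    nlinarith [sq_nonneg |2 * Real.pi * x|]
  · have h1 := norm_sub_le (expTurn x - 1) (2 * Real.pi * Complex.I * x)
    have h3 := norm_expTurn_sub_one_le x
    rw [hn] at h1
    rw [abs_mul, abs_of_pos Real.two_pi_pos] at *
    nlinarith

theorem trig_add_sub (A B C : ℂ) (α β ξ T : ℝ) :
    trig A B C α β (ξ + T) - trig A B C α β ξ =
      B * expTurn (α * ξ) * (expTurn (α * T) - 1) + C * expTurn (β * ξ) * (expTurn (β * T) - 1) := by
  simp only [trig, mul_add, expTurn_add]; ring

theorem norm_trig_add_le (A B C : ℂ) (α β ξ T : ℝ) :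
    ‖trig A B C α β (ξ + T)‖ ≤ ‖trig A B C α β ξ‖ +
      2 * Real.pi * (‖B‖ * distInt (α * T) + ‖C‖ * distInt (β * T)) := by
  have h := norm_add_le (trig A B C α β ξ) (trig A B C α β (ξ + T) - trig A B C α β ξ)
  rw [add_sub_cancel] at h
  refine h.trans (add_le_add le_rfl ?_)
  rw [trig_add_sub]
  refine (norm_add_le _ _).trans ?_
  simp only [norm_mul, norm_expTurn, mul_one]
  have h1 := mul_le_mul_of_nonneg_left (norm_expTurn_sub_one_le_distInt (α * T)) (norm_nonneg B)
  have h2 := mul_le_mul_of_nonneg_left (norm_expTurn_sub_one_le_distInt (β * T)) (norm_nonneg C)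
  linarith

theorem norm_trig_neg (A B C : ℂ) (α β ξ : ℝ) :
    ‖trig A B C (-α) (-β) ξ‖ =
      ‖trig (starRingEnd ℂ A) (starRingEnd ℂ B) (starRingEnd ℂ C) α β ξ‖ := by
  rw [← RCLike.norm_conj (trig A B C (-α) (-β) ξ)]
  congr 1
  simp [trig, conj_expTurn]

theorem hasDerivAt_expTurn (a ξ : ℝ) :
    HasDerivAt (fun ξ => expTurn (a * ξ)) (2 * Real.pi * Complex.I * a * expTurn (a * ξ)) ξ := by
  have h : HasDerivAt (fun ξ : ℝ => (2 * Real.pi * Complex.I * (a * ξ : ℝ) : ℂ))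
      (2 * Real.pi * Complex.I * a) ξ := by
    have := ((((hasDerivAt_id ξ).const_mul a).ofReal_comp).const_mul (2 * Real.pi * Complex.I : ℂ))
    simpa only [id, mul_one] using this
  exact h.cexp.congr_deriv (mul_comm _ _)

theorem hasDerivAt_trig (A B C : ℂ) (α β ξ : ℝ) :
    HasDerivAt (trig A B C α β)
      (trig 0 (2 * Real.pi * Complex.I * α * B) (2 * Real.pi * Complex.I * β * C) α β ξ) ξ := by
  have h := (((hasDerivAt_expTurn α ξ).const_mul B).const_add A).add
    ((hasDerivAt_expTurn β ξ).const_mul C)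
  refine h.congr_deriv ?_
  simp only [trig]; ring

@[fun_prop]
theorem continuous_expTurn : Continuous expTurn := by unfold expTurn; fun_prop

theorem continuous_trig (A B C : ℂ) (α β : ℝ) : Continuous (trig A B C α β) := by
  unfold trig; fun_prop

theorem analyticAt_expTurn (a ξ : ℝ) : AnalyticAt ℝ (fun ξ => expTurn (a * ξ)) ξ := by
  have h : AnalyticAt ℝ (fun ξ : ℝ => (2 * Real.pi * Complex.I : ℂ) * ((a * ξ : ℝ) : ℂ)) ξ :=
    analyticAt_const.mul
      ((Complex.ofRealCLM.analyticAt (a * ξ)).comp (analyticAt_const.mul analyticAt_id))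
  exact (analyticAt_cexp.restrictScalars (𝕜 := ℝ)).comp h

theorem analyticOnNhd_trig (A B C : ℂ) (α β : ℝ) :
    AnalyticOnNhd ℝ (trig A B C α β) Set.univ := fun ξ _ =>
  (analyticAt_const.add (analyticAt_const.mul (analyticAt_expTurn α ξ))).add
    (analyticAt_const.mul (analyticAt_expTurn β ξ))

/-- Characters of distinct frequencies are linearly independent. -/
theorem exists_trig_ne_zero {A B C : ℂ} {α β : ℝ} (hα : α ≠ 0) (hβ : β ≠ 0) (hαβ : α ≠ β)
    (h : ¬ (A = 0 ∧ B = 0 ∧ C = 0)) : ∃ ξ, trig A B C α β ξ ≠ 0 := by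
  by_contra! h0
  have key : ∀ {A B C : ℂ}, (∀ ξ, trig A B C α β ξ = 0) → ∀ ξ,
      trig 0 (2 * Real.pi * Complex.I * α * B) (2 * Real.pi * Complex.I * β * C) α β ξ = 0 := by
    intro A B C h ξ
    have h1 := hasDerivAt_trig A B C α β ξ
    rw [funext h] at h1
    exact h1.unique (hasDerivAt_const ξ 0)
  have e0 := h0 0
  have e1 := key h0 0
  have e2 := key (key h0) 0
  have hpi : (2 * Real.pi * Complex.I : ℂ) ≠ 0 := Complex.two_pi_I_ne_zero
  simp only [trig, mul_zero, expTurn_zero, mul_one, zero_add] at e0 e1 e2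
  have hα' : (α : ℂ) ≠ 0 := by exact_mod_cast hα
  have hβ' : (β : ℂ) ≠ 0 := by exact_mod_cast hβ
  have hαβ' : (β : ℂ) - α ≠ 0 := sub_ne_zero.2 (by exact_mod_cast hαβ.symm)
  have f1 : (2 * Real.pi * Complex.I : ℂ) * (α * B + β * C) = 0 := by linear_combination e1
  have f2 : (2 * Real.pi * Complex.I : ℂ) ^ 2 * (α ^ 2 * B + β ^ 2 * C) = 0 := by
    linear_combination e2
  have g1 := (mul_eq_zero.1 f1).resolve_left hpi
  have g2 := (mul_eq_zero.1 f2).resolve_left (pow_ne_zero 2 hpi)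
  have hC : C = 0 := by
    have : (β : ℂ) * (β - α) * C = 0 := by linear_combination g2 - α * g1
    exact (mul_eq_zero.1 this).resolve_left (mul_ne_zero hβ' hαβ')
  have hB : B = 0 := by
    rw [hC, mul_zero, add_zero] at g1
    exact (mul_eq_zero.1 g1).resolve_left hα'
  exact h ⟨by simpa [hB, hC] using e0, hB, hC⟩

theorem ae_trig_ne_zero {A B C : ℂ} {α β : ℝ} (hα : α ≠ 0) (hβ : β ≠ 0) (hαβ : α ≠ β)
    (h : ¬ (A = 0 ∧ B = 0 ∧ C = 0)) : ∀ᵐ ξ : ℝ, trig A B C α β ξ ≠ 0 := by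
  obtain ⟨ξ₀, h₀⟩ := exists_trig_ne_zero hα hβ hαβ h
  have h1 := (analyticOnNhd_trig A B C α β).preimage_zero_mem_codiscrete h₀
  have h2 := ae_restrict_le_codiscreteWithin (μ := volume) (U := (Set.univ : Set ℝ))
    MeasurableSet.univ h1
  rw [Measure.restrict_univ] at h2
  filter_upwards [h2] with ξ hξ using by simpa using hξ

/-! ### Lower bounds from a derivative, and integrals of logarithms -/

/-- If `f` and `f'` have no common approximate zero, then on short intervals `|f|` dominates a
multiple of the distance to a single point. -/
theorem exists_mul_abs_sub_le_norm {f f' : ℝ → ℂ} (hf : ∀ x, HasDerivAt f (f' x) x) {M c : ℝ}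
    (hM : ∀ x y, ‖f' x - f' y‖ ≤ M * |x - y|) (hc : 0 < c) (h : ∀ x, c ≤ ‖f x‖ + ‖f' x‖) :
    ∃ l > 0, l ≤ 1 ∧ ∀ a, ∃ z ∈ Set.Icc a (a + l), ∀ x ∈ Set.Icc a (a + l),
      c / 4 * |x - z| ≤ ‖f x‖ := by
  have hM0 : 0 ≤ M := by
    have := (norm_nonneg _).trans (hM 1 0)
    simpa using this
  refine ⟨min 1 (c / (4 * (M + 1))), by positivity, min_le_left _ _, fun a => ?_⟩
  set l := min 1 (c / (4 * (M + 1))) with hl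
  have hl0 : 0 < l := by positivity
  have hl1 : l ≤ 1 := min_le_left _ _
  have hlM : M * l ≤ c / 4 := by
    have h1 : l ≤ c / (4 * (M + 1)) := min_le_right _ _
    rw [le_div_iff₀ (by positivity)] at h1
    nlinarith
  have hcont : Continuous f := continuous_iff_continuousAt.2 fun x => (hf x).continuousAt
  obtain ⟨z, hz, hmin⟩ := isCompact_Icc.exists_isMinOn (s := Set.Icc a (a + l))
    (Set.nonempty_Icc.2 (by linarith)) hcont.norm.continuousOn
  refine ⟨z, hz, fun x hx => ?_⟩
  have hxz : |x - z| ≤ l := by rw [abs_le]; constructor <;> linarith [hx.1, hx.2, hz.1, hz.2]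
  have hfz : ‖f z‖ ≤ ‖f x‖ := hmin hx
  rcases le_or_gt (c / 4) ‖f z‖ with h1 | h1
  · nlinarith [abs_nonneg (x - z)]
  have hd : 3 * c / 4 ≤ ‖f' z‖ := by linarith [h z]
  have hmv : ‖(f x - f' z * x) - (f z - f' z * z)‖ ≤ c / 4 * ‖x - z‖ := by
    refine Convex.norm_image_sub_le_of_norm_hasDerivWithin_le (f := fun x : ℝ => f x - f' z * x)
      (f' := fun x => f' x - f' z) (s := Set.Icc a (a + l)) (fun y _ => ?_) (fun y hy => ?_)
      (convex_Icc _ _) hz hx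
    · have h2 := (hf y).sub (((hasDerivAt_id y).ofReal_comp).const_mul (f' z))
      rw [Complex.ofReal_one, mul_one] at h2
      exact h2.hasDerivWithinAt
    · refine (hM y z).trans (le_trans (mul_le_mul_of_nonneg_left ?_ hM0) hlM)
      rw [abs_le]; constructor <;> linarith [hy.1, hy.2, hz.1, hz.2]
  have h3 : f' z * ((x - z : ℝ) : ℂ) =
      (f x - f z) - ((f x - f' z * x) - (f z - f' z * z)) := by push_cast; ring
  have h4 : ‖f' z‖ * |x - z| ≤ ‖f x‖ + ‖f z‖ + c / 4 * |x - z| := by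
    rw [← Real.norm_eq_abs, ← Complex.norm_real (x - z), ← norm_mul, h3, Complex.norm_real]
    exact (norm_sub_le _ _).trans (add_le_add (norm_sub_le _ _) hmv)
  nlinarith [abs_nonneg (x - z), mul_le_mul_of_nonneg_right hd (abs_nonneg (x - z))]

theorem log_one_add_le_two_mul_sqrt {y : ℝ} (hy : 0 ≤ y) : Real.log (1 + y) ≤ 2 * √y := by
  rw [Real.log_le_iff_le_exp (by linarith)]
  have h := Real.quadratic_le_exp_of_nonneg (x := 2 * √y) (by positivity)
  nlinarith [Real.sq_sqrt hy, Real.sqrt_nonneg y]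

theorem log_one_add_le_self {y : ℝ} (hy : 0 ≤ y) : Real.log (1 + y) ≤ y := by
  have := Real.log_le_sub_one_of_pos (x := 1 + y) (by linarith)
  linarith

theorem log_one_add_nonneg {y : ℝ} (hy : 0 ≤ y) : 0 ≤ Real.log (1 + y) :=
  Real.log_nonneg (by linarith)

/-- A set integral over `[x, x + k h]` is at most the sum of the integrals over `k` consecutive
intervals of length `h`. -/
theorem setLIntegral_Icc_nat_mul_le_sum (F : ℝ → ENNReal) (h : ℝ) (k : ℕ) (x : ℝ) :
    ∫⁻ ξ in Set.Icc x (x + k * h), F ξ ≤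
      ∑ i ∈ Finset.range k, ∫⁻ ξ in Set.Icc (x + i * h) (x + i * h + h), F ξ := by
  induction k with
  | zero => simp
  | succ k ih =>
    have hsub : Set.Icc x (x + (k + 1 : ℕ) * h) ⊆
        Set.Icc x (x + k * h) ∪ Set.Icc (x + k * h) (x + k * h + h) := by
      intro ξ hξ
      rcases le_total ξ (x + k * h) with h1 | h1
      · exact Or.inl ⟨hξ.1, h1⟩
      · refine Or.inr ⟨h1, hξ.2.trans (le_of_eq ?_)⟩
        push_cast; ring
    rw [Finset.sum_range_succ]
    exact (lintegral_mono_set hsub).trans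
      ((lintegral_union_le _ _ _).trans (add_le_add ih le_rfl))

theorem setLIntegral_Icc_nat_mul_le {F : ℝ → ENNReal} {h : ℝ} {K : ENNReal}
    (hK : ∀ x, ∫⁻ ξ in Set.Icc x (x + h), F ξ ≤ K) (k : ℕ) (x : ℝ) :
    ∫⁻ ξ in Set.Icc x (x + k * h), F ξ ≤ k * K := by
  refine (setLIntegral_Icc_nat_mul_le_sum F h k x).trans
    ((Finset.sum_le_sum fun (i : ℕ) _ => hK (x + i * h)).trans (le_of_eq ?_))
  simp

/-- The integral of an even function over a symmetric interval. -/
theorem setLIntegral_abs_sub_le (H : ℝ → ENNReal) (z l : ℝ) :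
    ∫⁻ x in Set.Icc (z - l) (z + l), H |x - z| ≤ 2 * ∫⁻ t in Set.Ioc 0 l, H t := by
  have hsub : Set.Icc (z - l) (z + l) ⊆
      {z} ∪ ((fun x => x - z) ⁻¹' Set.Ioc 0 l ∪ (fun x => z - x) ⁻¹' Set.Ioc 0 l) := by
    intro x hx
    rcases lt_trichotomy x z with h | h | h
    · exact Or.inr (Or.inr ⟨by simpa using h, by linarith [hx.1]⟩)
    · exact Or.inl h
    · exact Or.inr (Or.inl ⟨by simpa using h, by linarith [hx.2]⟩)
  have e1 : ∫⁻ x in (fun x => x - z) ⁻¹' Set.Ioc 0 l, H |x - z| = ∫⁻ t in Set.Ioc 0 l, H t := by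
    rw [(measurePreserving_sub_right volume z).setLIntegral_comp_preimage_emb
      (measurableEmbedding_subRight z) (fun t => H |t|) (Set.Ioc 0 l)]
    refine setLIntegral_congr_fun measurableSet_Ioc fun t ht => ?_
    simp only [abs_of_pos ht.1]
  have e2 : ∫⁻ x in (fun x => z - x) ⁻¹' Set.Ioc 0 l, H |x - z| = ∫⁻ t in Set.Ioc 0 l, H t := by
    have := (volume.measurePreserving_sub_left z).setLIntegral_comp_preimage_emb
      (MeasurableEquiv.subLeft z).measurableEmbedding (fun t => H |t|) (Set.Ioc 0 l)
    simp_rw [abs_sub_comm _ z]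
    rw [this]
    refine setLIntegral_congr_fun measurableSet_Ioc fun t ht => ?_
    simp only [abs_of_pos ht.1]
  calc _ ≤ ∫⁻ x in {z} ∪ ((fun x => x - z) ⁻¹' Set.Ioc 0 l ∪ (fun x => z - x) ⁻¹' Set.Ioc 0 l),
        H |x - z| := lintegral_mono_set hsub
    _ ≤ 0 + ((∫⁻ t in Set.Ioc 0 l, H t) + ∫⁻ t in Set.Ioc 0 l, H t) := by
        refine (lintegral_union_le _ _ _).trans (add_le_add ?_ ?_)
        · simp
        · exact (lintegral_union_le _ _ _).trans (add_le_add e1.le e2.le)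
    _ = _ := by rw [zero_add, two_mul]

theorem setLIntegral_rpow_neg_half {l : ℝ} (hl : 0 ≤ l) :
    ∫⁻ t in Set.Ioc 0 l, ENNReal.ofReal (t ^ (-(1 / 2) : ℝ)) = ENNReal.ofReal (2 * √l) := by
  have hi : IntervalIntegrable (fun t : ℝ => t ^ (-(1 / 2) : ℝ)) volume 0 l :=
    intervalIntegral.intervalIntegrable_rpow' (by norm_num)
  rw [intervalIntegrable_iff_integrableOn_Ioc_of_le hl] at hi
  rw [← ofReal_integral_eq_lintegral_ofReal hi
    ((ae_restrict_iff' measurableSet_Ioc).2 (ae_of_all _ fun t ht => Real.rpow_nonneg ht.1.le _)),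
    ← intervalIntegral.integral_of_le hl, integral_rpow (Or.inl (by norm_num)), Real.sqrt_eq_rpow]
  congr 1
  norm_num
  ring

theorem setLIntegral_inv {a b : ℝ} (ha : 0 < a) (hab : a ≤ b) :
    ∫⁻ t in Set.Ioc a b, ENNReal.ofReal t⁻¹ = ENNReal.ofReal (Real.log (b / a)) := by
  have hi : IntervalIntegrable (fun t : ℝ => t⁻¹) volume a b := by
    refine intervalIntegral.intervalIntegrable_inv (fun t ht => ?_) continuousOn_id
    rw [Set.uIcc_of_le hab] at ht
    exact (ha.trans_le ht.1).ne'
  rw [intervalIntegrable_iff_integrableOn_Ioc_of_le hab] at hi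
  rw [← ofReal_integral_eq_lintegral_ofReal hi
    ((ae_restrict_iff' measurableSet_Ioc).2 (ae_of_all _ fun t ht => by
      have := ha.trans ht.1
      simp only [Pi.zero_apply]; positivity)),
    ← intervalIntegral.integral_of_le hab, integral_inv_of_pos ha (ha.trans_le hab)]

/-- `∫₀¹ log(1 + E / (n t log n)) dt = O(1/n)`. -/
theorem setLIntegral_log_one_add_div_le {E : ℝ} (hE : 0 ≤ E) {n : ℕ} (hn : 3 ≤ n) :
    ∫⁻ t in Set.Ioc (0 : ℝ) 1, ENNReal.ofReal (Real.log (1 + E / (n * Real.log n) / t)) ≤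
      ENNReal.ofReal ((4 * √E + E) / n) := by
  have hn3 : (3 : ℝ) ≤ n := by exact_mod_cast hn
  have hn0 : (0 : ℝ) < n := by linarith
  have hlog : 1 ≤ Real.log n := by
    rw [Real.le_log_iff_exp_le hn0]
    linarith [Real.exp_one_lt_d9]
  have hn1 : (n : ℝ)⁻¹ ≤ 1 := inv_le_one_of_one_le₀ (by linarith)
  have hsub : Set.Ioc (0 : ℝ) 1 ⊆ Set.Ioc 0 (n : ℝ)⁻¹ ∪ Set.Ioc (n : ℝ)⁻¹ 1 := by
    rw [Set.Ioc_union_Ioc_eq_Ioc (by positivity) hn1]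
  refine (lintegral_mono_set hsub).trans ((lintegral_union_le _ _ _).trans ?_)
  rw [add_div, ENNReal.ofReal_add (by positivity) (by positivity)]
  refine add_le_add ?_ ?_
  · calc _ ≤ ∫⁻ t in Set.Ioc (0 : ℝ) (n : ℝ)⁻¹,
          ENNReal.ofReal (2 * √(E / n)) * ENNReal.ofReal (t ^ (-(1 / 2) : ℝ)) := by
          refine setLIntegral_mono' measurableSet_Ioc fun t ht => ?_
          have ht0 := ht.1
          rw [← ENNReal.ofReal_mul (by positivity)]
          refine ENNReal.ofReal_le_ofReal ?_
          refine (log_one_add_le_two_mul_sqrt (by positivity)).trans ?_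
          rw [Real.rpow_neg ht0.le, ← Real.sqrt_eq_rpow, mul_assoc, ← Real.sqrt_inv,
            ← Real.sqrt_mul (by positivity), div_eq_mul_inv (E / (n * Real.log n))]
          gcongr
          nlinarith
      _ = ENNReal.ofReal (2 * √(E / n)) * ENNReal.ofReal (2 * √(n : ℝ)⁻¹) := by
          rw [lintegral_const_mul _ (by fun_prop), setLIntegral_rpow_neg_half (by positivity)]
      _ = _ := by
          rw [← ENNReal.ofReal_mul (by positivity)]
          congr 1
          rw [Real.sqrt_div hE, Real.sqrt_inv]
          have := Real.mul_self_sqrt hn0.le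
          field_simp
          rw [Real.sq_sqrt hn0.le]
          ring
  · calc _ ≤ ∫⁻ t in Set.Ioc (n : ℝ)⁻¹ 1,
          ENNReal.ofReal (E / (n * Real.log n)) * ENNReal.ofReal t⁻¹ := by
          refine setLIntegral_mono' measurableSet_Ioc fun t ht => ?_
          have ht0 : 0 < t := lt_trans (by positivity) ht.1
          rw [← ENNReal.ofReal_mul (by positivity)]
          exact ENNReal.ofReal_le_ofReal (log_one_add_le_self (by positivity))
      _ = ENNReal.ofReal (E / (n * Real.log n)) * ENNReal.ofReal (Real.log n) := by
          rw [lintegral_const_mul _ (by fun_prop), setLIntegral_inv (by positivity) hn1]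
          simp
      _ ≤ _ := by
          rw [← ENNReal.ofReal_mul (by positivity)]
          refine ENNReal.ofReal_le_ofReal (le_of_eq ?_)
          field_simp

theorem setLIntegral_log_one_add_div_sq_lt_top {E : ℝ} (hE : 0 ≤ E) {l : ℝ} (hl : 0 ≤ l) :
    ∫⁻ t in Set.Ioc 0 l, ENNReal.ofReal (Real.log (1 + E / t ^ 2)) < ⊤ := by
  calc _ ≤ ∫⁻ t in Set.Ioc (0 : ℝ) l,
        ENNReal.ofReal (4 * √(√E)) * ENNReal.ofReal (t ^ (-(1 / 2) : ℝ)) := by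
        refine setLIntegral_mono' measurableSet_Ioc fun t ht => ?_
        have ht0 := ht.1
        rw [← ENNReal.ofReal_mul (by positivity)]
        refine ENNReal.ofReal_le_ofReal ?_
        have h1 : 1 + E / t ^ 2 ≤ (1 + √E / t) ^ 2 := by
          rw [add_sq, div_pow, Real.sq_sqrt hE]
          have : 0 ≤ √E / t := by positivity
          linarith
        calc Real.log (1 + E / t ^ 2) ≤ Real.log ((1 + √E / t) ^ 2) :=
              Real.log_le_log (by positivity) h1
          _ = 2 * Real.log (1 + √E / t) := by rw [Real.log_pow]; norm_num
          _ ≤ 2 * (2 * √(√E / t)) := by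
              gcongr; exact log_one_add_le_two_mul_sqrt (by positivity)
          _ = _ := by
              rw [Real.rpow_neg ht0.le, ← Real.sqrt_eq_rpow, Real.sqrt_div (by positivity)]; ring
    _ = ENNReal.ofReal (4 * √(√E)) * ENNReal.ofReal (2 * √l) := by
        rw [lintegral_const_mul _ (by fun_prop), setLIntegral_rpow_neg_half hl]
    _ < ⊤ := ENNReal.mul_lt_top ENNReal.ofReal_lt_top ENNReal.ofReal_lt_top

/-! ### Double zeros of trigonometric polynomials -/

theorem trig_swap (A B C : ℂ) (α β ξ : ℝ) : trig A C B β α ξ = trig A B C α β ξ := by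
  simp only [trig]; ring

theorem norm_trig_sub_le (A B C : ℂ) (α β x y : ℝ) :
    ‖trig A B C α β x - trig A B C α β y‖ ≤
      2 * Real.pi * (‖B‖ * |α| + ‖C‖ * |β|) * |x - y| := by
  have h := trig_add_sub A B C α β y (x - y)
  rw [add_sub_cancel] at h
  rw [h]
  refine (norm_add_le _ _).trans ?_
  simp only [norm_mul, norm_expTurn, mul_one]
  have h1 := mul_le_mul_of_nonneg_left (norm_expTurn_sub_one_le (α * (x - y))) (norm_nonneg B)
  have h2 := mul_le_mul_of_nonneg_left (norm_expTurn_sub_one_le (β * (x - y))) (norm_nonneg C)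
  rw [abs_mul] at h1 h2
  linarith

/-- With `p = A + b + c` and `q = αb + βc` one has `(β - α) b + βA = β p - q`, so small values of
`p` and `q` force `|β - α| |b|` to be close to `|β| |A|`. -/
theorem le_norm_trig_add_norm_deriv (A B C : ℂ) (α β ξ : ℝ) :
    |‖B‖ * |β - α| - |β| * ‖A‖| ≤ (|β| + 1) * (‖trig A B C α β ξ‖ +
      ‖trig 0 (2 * Real.pi * Complex.I * α * B) (2 * Real.pi * Complex.I * β * C) α β ξ‖) := by
  set p := trig A B C α β ξ with hp
  set q := trig 0 (2 * Real.pi * Complex.I * α * B) (2 * Real.pi * Complex.I * β * C) α β ξ with hq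
  set q' : ℂ := α * (B * expTurn (α * ξ)) + β * (C * expTurn (β * ξ)) with hq'
  have hqq : q = 2 * Real.pi * Complex.I * q' := by simp only [hq, hq', trig]; ring
  have h1 : ‖q'‖ ≤ ‖q‖ := by
    have hpi := Real.pi_gt_three
    rw [hqq, norm_mul]
    have : ‖(2 * Real.pi * Complex.I : ℂ)‖ = 2 * Real.pi := by
      simp [abs_of_pos Real.pi_pos]
    rw [this]
    nlinarith [norm_nonneg q']
  have h2 : ((β - α : ℝ) : ℂ) * (B * expTurn (α * ξ)) - -((β : ℂ) * A) = β * p - q' := by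
    simp only [hp, hq', trig]; push_cast; ring
  have h3 := abs_norm_sub_norm_le (((β - α : ℝ) : ℂ) * (B * expTurn (α * ξ))) (-((β : ℂ) * A))
  rw [h2, norm_neg, norm_mul, norm_mul, norm_mul, norm_expTurn, mul_one, Complex.norm_real,
    Complex.norm_real, Real.norm_eq_abs, Real.norm_eq_abs, mul_comm |β - α|] at h3
  have h4 := norm_sub_le ((β : ℂ) * p) q'
  rw [norm_mul, Complex.norm_real, Real.norm_eq_abs] at h4
  nlinarith [mul_nonneg (abs_nonneg β) (norm_nonneg q), norm_nonneg p]

/-- Unless the moduli of the coefficients have the proportions `|β - α| : |β| : |α|`, the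
trigonometric polynomial and its derivative have no common approximate zero. -/
theorem exists_le_norm_trig_add_norm_deriv {A B C : ℂ} {α β : ℝ}
    (h : ¬ (‖B‖ * |β - α| = |β| * ‖A‖ ∧ ‖C‖ * |β - α| = |α| * ‖A‖)) :
    ∃ c > 0, ∀ ξ, c ≤ ‖trig A B C α β ξ‖ +
      ‖trig 0 (2 * Real.pi * Complex.I * α * B) (2 * Real.pi * Complex.I * β * C) α β ξ‖ := by
  rw [not_and_or] at h
  rcases h with h | h
  · refine ⟨|‖B‖ * |β - α| - |β| * ‖A‖| / (|β| + 1),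
      div_pos (abs_pos.2 (sub_ne_zero.2 h)) (by positivity), fun ξ => ?_⟩
    rw [div_le_iff₀' (by positivity)]
    exact le_norm_trig_add_norm_deriv A B C α β ξ
  · refine ⟨|‖C‖ * |α - β| - |α| * ‖A‖| / (|α| + 1),
      div_pos (abs_pos.2 (sub_ne_zero.2 (by rwa [abs_sub_comm]))) (by positivity), fun ξ => ?_⟩
    rw [div_le_iff₀' (by positivity), ← trig_swap A, ← trig_swap 0]
    exact le_norm_trig_add_norm_deriv A C B β α ξ

theorem exists_lintegral_log_le_of_no_double_zero {A B C : ℂ} {α β : ℝ} (hα : 0 < α)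
    (h : ¬ (‖B‖ * |β - α| = |β| * ‖A‖ ∧ ‖C‖ * |β - α| = |α| * ‖A‖)) {D : ℝ} (hD : 0 ≤ D) :
    ∃ K : ENNReal, K < ⊤ ∧ ∀ n : ℕ, 3 ≤ n → ∀ x : ℝ, ∫⁻ ξ in Set.Icc x (x + n / α),
      ENNReal.ofReal (Real.log (1 + D / (n * Real.log n) / ‖trig A B C α β ξ‖)) ≤ K := by
  obtain ⟨c, hc, hcP⟩ := exists_le_norm_trig_add_norm_deriv h
  obtain ⟨l, hl, hl1, hz⟩ := exists_mul_abs_sub_le_norm (hasDerivAt_trig A B C α β)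
    (norm_trig_sub_le _ _ _ _ _) hc hcP
  set E := 4 * D / c with hE
  have hE0 : 0 ≤ E := by positivity
  have hpiece : ∀ n : ℕ, 3 ≤ n → ∀ a : ℝ, ∫⁻ ξ in Set.Icc a (a + l),
      ENNReal.ofReal (Real.log (1 + D / (n * Real.log n) / ‖trig A B C α β ξ‖)) ≤
        2 * ENNReal.ofReal ((4 * √E + E) / n) := by
    intro n hn a
    obtain ⟨z, hza, hzP⟩ := hz a
    have hsub : Set.Icc a (a + l) ⊆ Set.Icc (z - 1) (z + 1) := fun ξ hξ =>
      ⟨by linarith [hξ.1, hza.2], by linarith [hξ.2, hza.1]⟩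
    calc _ ≤ ∫⁻ ξ in Set.Icc a (a + l),
          ENNReal.ofReal (Real.log (1 + E / (n * Real.log n) / |ξ - z|)) := by
          have hne : ∀ᵐ ξ ∂volume.restrict (Set.Icc a (a + l)), ξ ≠ z :=
            ae_restrict_of_ae (by simp [ae_iff])
          refine lintegral_mono_ae ?_
          filter_upwards [hne, ae_restrict_mem measurableSet_Icc] with ξ h1 h2
          have h3 : 0 < |ξ - z| := abs_pos.2 (sub_ne_zero.2 h1)
          have h4 := hzP ξ h2
          have hlog : 0 ≤ Real.log n := Real.log_natCast_nonneg n
          have h5 : 0 < ‖trig A B C α β ξ‖ := lt_of_lt_of_le (by positivity) h4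
          refine ENNReal.ofReal_le_ofReal (Real.log_le_log (by positivity) ?_)
          have h6 : D / (n * Real.log n) / ‖trig A B C α β ξ‖ ≤
              D / (n * Real.log n) / (c / 4 * |ξ - z|) := by gcongr
          refine add_le_add le_rfl (h6.trans (le_of_eq ?_))
          rw [hE]; field_simp
      _ ≤ _ := lintegral_mono_set hsub
      _ ≤ _ := setLIntegral_abs_sub_le
          (fun t => ENNReal.ofReal (Real.log (1 + E / (n * Real.log n) / t))) z 1
      _ ≤ _ := by gcongr; exact setLIntegral_log_one_add_div_le hE0 hn
  refine ⟨ENNReal.ofReal ((1 / (α * l) + 1) * (2 * (4 * √E + E))), ENNReal.ofReal_lt_top,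
    fun n hn x => ?_⟩
  have hn0 : (0 : ℝ) < n := by exact_mod_cast (by omega : 0 < n)
  set k := ⌈n / (α * l)⌉₊ with hk
  have hk1 : n / α ≤ k * l := by
    have := Nat.le_ceil (n / (α * l))
    rw [← hk, div_le_iff₀ (by positivity)] at this
    rw [div_le_iff₀ hα]; linarith
  have hk2 : (k : ℝ) ≤ n * (1 / (α * l) + 1) := by
    have := Nat.ceil_lt_add_one (a := n / (α * l)) (by positivity)
    have h3 : (3 : ℝ) ≤ n := by exact_mod_cast hn
    rw [← hk] at this
    have h4 : n * (1 / (α * l) + 1) = n / (α * l) + n := by ring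
    linarith
  calc _ ≤ _ := lintegral_mono_set (Set.Icc_subset_Icc_right (by linarith))
    _ ≤ k * (2 * ENNReal.ofReal ((4 * √E + E) / n)) :=
        setLIntegral_Icc_nat_mul_le (hpiece n hn) k x
    _ = ENNReal.ofReal (k * (2 * ((4 * √E + E) / n))) := by
        rw [ENNReal.ofReal_mul (by positivity), ENNReal.ofReal_mul (by norm_num)]
        simp
    _ ≤ _ := by
        refine ENNReal.ofReal_le_ofReal ?_
        calc _ ≤ n * (1 / (α * l) + 1) * (2 * ((4 * √E + E) / n)) := by gcongr
          _ = _ := by field_simp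

/-! ### The degenerate trinomial -/

theorem norm_sq_expTurn_sub_one (x : ℝ) : ‖expTurn x - 1‖ ^ 2 = -2 * (expTurn x - 1).re := by
  have h := norm_expTurn x
  have h2 : ‖expTurn x‖ ^ 2 = 1 := by rw [h]; norm_num
  rw [← Complex.normSq_eq_norm_sq, Complex.normSq_apply] at *
  simp only [Complex.sub_re, Complex.sub_im, Complex.one_re, Complex.one_im]
  linarith

theorem norm_expTurn_sub_one_le_two (x : ℝ) : ‖expTurn x - 1‖ ≤ 2 := by
  have := norm_sub_le (expTurn x) 1
  rw [norm_expTurn, norm_one] at this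
  linarith

/-- The points `u = exp(2πiX) - 1` and `v = exp(2πiY) - 1` lie on the circle `|z|² = -2 Re z`;
expanding `|βu|²` for `βu = αv + p` in two ways gives
`α (β - α) |v|² = 2β Re p + 2α Re (v * conj p) + |p|²`. -/
theorem mul_norm_sq_expTurn_sub_one_le (α β X Y : ℝ) :
    |α| * |β - α| * ‖expTurn Y - 1‖ ^ 2 ≤
      8 * (|α| + |β|) * ‖(β : ℂ) * (expTurn X - 1) - α * (expTurn Y - 1)‖ := by
  set u := expTurn X - 1 with hu
  set v := expTurn Y - 1 with hv
  set p := (β : ℂ) * u - α * v with hp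
  have hu2 : ‖u‖ ^ 2 = -2 * u.re := norm_sq_expTurn_sub_one X
  have hv2 : ‖v‖ ^ 2 = -2 * v.re := norm_sq_expTurn_sub_one Y
  have hu' : ‖u‖ ≤ 2 := norm_expTurn_sub_one_le_two X
  have hv' : ‖v‖ ≤ 2 := norm_expTurn_sub_one_le_two Y
  have hpn : ‖p‖ ≤ 2 * (|α| + |β|) := by
    refine (norm_sub_le _ _).trans ?_
    rw [norm_mul, norm_mul, Complex.norm_real, Complex.norm_real, Real.norm_eq_abs,
      Real.norm_eq_abs]
    nlinarith [abs_nonneg α, abs_nonneg β]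
  have hpre : p.re = β * u.re - α * v.re := by simp [hp]
  have hpim : p.im = β * u.im - α * v.im := by simp [hp]
  have key : α * (β - α) * ‖v‖ ^ 2 =
      2 * β * p.re + 2 * α * (v.re * p.re + v.im * p.im) + ‖p‖ ^ 2 := by
    have eu : u.re * u.re + u.im * u.im = -2 * u.re := by
      rw [← hu2, ← Complex.normSq_eq_norm_sq, Complex.normSq_apply]
    have ev : v.re * v.re + v.im * v.im = -2 * v.re := by
      rw [← hv2, ← Complex.normSq_eq_norm_sq, Complex.normSq_apply]
    rw [hv2, ← Complex.normSq_eq_norm_sq, Complex.normSq_apply, hpre, hpim]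
    linear_combination -β ^ 2 * eu + α ^ 2 * ev
  have h1 : |v.re * p.re + v.im * p.im| ≤ ‖v‖ * ‖p‖ := by
    have := Complex.abs_re_le_norm (v * (starRingEnd ℂ) p)
    rw [norm_mul, RCLike.norm_conj] at this
    simpa using this
  have h2 := Complex.abs_re_le_norm p
  have h3 : |α| * |β - α| * ‖v‖ ^ 2 = |α * (β - α) * ‖v‖ ^ 2| := by
    rw [abs_mul, abs_mul, abs_of_nonneg (sq_nonneg ‖v‖)]
  rw [h3, key]
  have h4 : |2 * β * p.re + 2 * α * (v.re * p.re + v.im * p.im) + ‖p‖ ^ 2| ≤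
      2 * |β| * |p.re| + 2 * |α| * |v.re * p.re + v.im * p.im| + ‖p‖ ^ 2 := by
    refine (abs_add_le _ _).trans (add_le_add ((abs_add_le _ _).trans (le_of_eq ?_)) (le_of_eq ?_))
    · simp only [abs_mul, abs_two]
    · exact abs_of_nonneg (sq_nonneg _)
  have h5 : |β| * |p.re| ≤ |β| * ‖p‖ := by gcongr
  have h6 : |α| * |v.re * p.re + v.im * p.im| ≤ |α| * (2 * ‖p‖) := by
    refine mul_le_mul_of_nonneg_left (h1.trans ?_) (abs_nonneg _)
    gcongr
  have h7 : ‖p‖ ^ 2 ≤ 2 * (|α| + |β|) * ‖p‖ := by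
    rw [sq]; gcongr
  nlinarith [mul_nonneg (abs_nonneg β) (norm_nonneg p), mul_nonneg (abs_nonneg α) (norm_nonneg p)]

/-- Near its zero, `β (exp(2πiX) - 1) - α (exp(2πiY) - 1)` is as large as its linear part
`2πi (βX - αY)` and as the square of `X`. -/
theorem exists_degenerate_lower_bound {α β : ℝ} (hα : α ≠ 0) (hβ : β ≠ 0) (hαβ : α ≠ β) :
    ∃ K > 0, ∀ X Y : ℝ, |X| ≤ 1 / 2 → |Y| ≤ 1 / 2 →
      X ^ 2 ≤ K * ‖(β : ℂ) * (expTurn X - 1) - α * (expTurn Y - 1)‖ ∧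
      |β * X - α * Y| ≤ K * ‖(β : ℂ) * (expTurn X - 1) - α * (expTurn Y - 1)‖ := by
  have ha : 0 < |α| := abs_pos.2 hα
  have hb : 0 < |β| := abs_pos.2 hβ
  have hab : 0 < |β - α| := abs_pos.2 (sub_ne_zero.2 hαβ.symm)
  set s := 8 * (|α| + |β|) with hs
  have hs0 : 0 < s := by positivity
  set K₁ := s / (|β| * |β - α|) with hK₁
  set K₂ := s / (|α| * |β - α|) with hK₂
  have hK₁0 : 0 < K₁ := by positivity
  have hK₂0 : 0 < K₂ := by positivity
  refine ⟨K₁ + (1 + 8 * Real.pi ^ 2 * (|β| * K₁ + |α| * K₂)), by positivity, fun X Y hX hY => ?_⟩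
  set p := (β : ℂ) * (expTurn X - 1) - α * (expTurn Y - 1) with hp
  have hpi := Real.pi_gt_three
  have hv := mul_norm_sq_expTurn_sub_one_le α β X Y
  have hu := mul_norm_sq_expTurn_sub_one_le β α Y X
  rw [← hp, ← hs, ← le_div_iff₀' (by positivity), mul_div_right_comm, ← hK₂] at hv
  rw [norm_sub_rev (_ * _), ← hp, add_comm |β|, ← hs, abs_sub_comm, ← le_div_iff₀' (by positivity),
    mul_div_right_comm, ← hK₁] at hu
  have hX1 : X ^ 2 ≤ K₁ * ‖p‖ := by
    have := four_mul_abs_le_norm_expTurn_sub_one hX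
    rw [← sq_abs]
    nlinarith [abs_nonneg X]
  have hY1 : Y ^ 2 ≤ K₂ * ‖p‖ := by
    have := four_mul_abs_le_norm_expTurn_sub_one hY
    rw [← sq_abs]
    nlinarith [abs_nonneg Y]
  have hp0 := norm_nonneg p
  have hextra : 0 ≤ (1 + 8 * Real.pi ^ 2 * (|β| * K₁ + |α| * K₂)) * ‖p‖ := by positivity
  refine ⟨by linarith, ?_⟩
  have e : 2 * Real.pi * Complex.I * ((β * X - α * Y : ℝ) : ℂ) = p -
      (β * (expTurn X - 1 - 2 * Real.pi * Complex.I * X) -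
        α * (expTurn Y - 1 - 2 * Real.pi * Complex.I * Y)) := by
    rw [hp]; push_cast; ring
  have hn : ‖2 * Real.pi * Complex.I * ((β * X - α * Y : ℝ) : ℂ)‖ =
      2 * Real.pi * |β * X - α * Y| := by
    rw [norm_mul, Complex.norm_real, Real.norm_eq_abs]
    congr 1
    simp [abs_of_pos Real.pi_pos]
  have h1 : 2 * Real.pi * |β * X - α * Y| ≤
      ‖p‖ + (|β| * (2 * (2 * Real.pi * X) ^ 2) + |α| * (2 * (2 * Real.pi * Y) ^ 2)) := by
    rw [← hn, e]
    refine (norm_sub_le _ _).trans (add_le_add le_rfl ((norm_sub_le _ _).trans ?_))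
    rw [norm_mul, norm_mul, Complex.norm_real, Complex.norm_real, Real.norm_eq_abs,
      Real.norm_eq_abs]
    gcongr <;> exact norm_expTurn_sub_one_sub_le _
  have h2 : |β| * (2 * (2 * Real.pi * X) ^ 2) ≤ 8 * Real.pi ^ 2 * (|β| * K₁) * ‖p‖ := by
    have := mul_le_mul_of_nonneg_left hX1 (by positivity : 0 ≤ 8 * Real.pi ^ 2 * |β|)
    linarith
  have h3 : |α| * (2 * (2 * Real.pi * Y) ^ 2) ≤ 8 * Real.pi ^ 2 * (|α| * K₂) * ‖p‖ := by
    have := mul_le_mul_of_nonneg_left hY1 (by positivity : 0 ≤ 8 * Real.pi ^ 2 * |α|)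
    linarith
  have h4 : |β * X - α * Y| ≤ 2 * Real.pi * |β * X - α * Y| := by
    nlinarith [abs_nonneg (β * X - α * Y)]
  have h5 : 0 ≤ K₁ * ‖p‖ := by positivity
  linarith

/-! ### Logarithmic integrals over long intervals -/

theorem distInt_le_abs_sub_int (x : ℝ) (k : ℤ) : distInt x ≤ |x - k| := round_le x k

theorem distInt_nonneg (x : ℝ) : 0 ≤ distInt x := abs_nonneg _

theorem distInt_sub_abs_le (x y : ℝ) : distInt x - |y| ≤ distInt (x + y) := by
  have h := distInt_le_abs_sub_int x (round (x + y))
  have h2 := abs_add_le (x + y - round (x + y)) (-y)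
  rw [abs_neg, show x + y - round (x + y) + -y = x - round (x + y) by ring] at h2
  unfold distInt at *
  linarith

theorem exists_expTurn_eq {w : ℂ} (hw : ‖w‖ = 1) : ∃ θ : ℝ, expTurn θ = w := by
  refine ⟨w.arg / (2 * Real.pi), ?_⟩
  have h := Complex.norm_mul_exp_arg_mul_I w
  rw [hw, Complex.ofReal_one, one_mul] at h
  refine Eq.trans ?_ h
  rw [expTurn]
  congr 1
  have hpi : (Real.pi : ℂ) ≠ 0 := by exact_mod_cast Real.pi_ne_zero
  push_cast
  field_simp

/-- In the degenerate case the modulus of the trigonometric polynomial is bounded below by the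
square of the distance from `αξ + θ` to a nearest integer `a`, and by the distance from
`(β/α) a + κ` to the integers. -/
theorem exists_degenerate_trig_lower_bound {A B C : ℂ} {α β : ℝ} (hα : α ≠ 0) (hβ : β ≠ 0)
    (hαβ : α ≠ β) (hA : A ≠ 0) (hB : ‖B‖ * |β - α| = |β| * ‖A‖)
    (hC : ‖C‖ * |β - α| = |α| * ‖A‖) :
    ∃ c > 0, ∃ θ κ : ℝ, ∀ (ξ : ℝ) (a : ℤ), |α * ξ + θ - a| ≤ 1 / 2 →
      c * (α * ξ + θ - a) ^ 2 ≤ ‖trig A B C α β ξ‖ ∧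
      c * distInt (β / α * a + κ) ≤ ‖trig A B C α β ξ‖ := by
  have hα' : (α : ℂ) ≠ 0 := by exact_mod_cast hα
  have hβ' : (β : ℂ) ≠ 0 := by exact_mod_cast hβ
  have hαβ' : (α : ℂ) - β ≠ 0 := sub_ne_zero.2 (by exact_mod_cast hαβ)
  set lam : ℂ := A / (α - β) with hlam
  have hlam0 : lam ≠ 0 := div_ne_zero hA hαβ'
  have hnl : ‖lam‖ * |β - α| = ‖A‖ := by
    rw [hlam, norm_div, ← Complex.ofReal_sub, Complex.norm_real, Real.norm_eq_abs, abs_sub_comm]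
    exact div_mul_cancel₀ _ (abs_pos.2 (sub_ne_zero.2 hαβ.symm)).ne'
  have hab : |β - α| ≠ 0 := (abs_pos.2 (sub_ne_zero.2 hαβ.symm)).ne'
  obtain ⟨θ, hθ⟩ := exists_expTurn_eq (w := B / (lam * β)) (by
    rw [norm_div, norm_mul, Complex.norm_real, Real.norm_eq_abs,
      div_eq_one_iff_eq (mul_ne_zero (norm_ne_zero_iff.2 hlam0) (abs_ne_zero.2 hβ))]
    refine mul_right_cancel₀ hab ?_
    rw [hB, ← hnl]; ring)
  obtain ⟨φ, hφ⟩ := exists_expTurn_eq (w := -C / (lam * α)) (by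
    rw [norm_div, norm_mul, norm_neg, Complex.norm_real, Real.norm_eq_abs,
      div_eq_one_iff_eq (mul_ne_zero (norm_ne_zero_iff.2 hlam0) (abs_ne_zero.2 hα))]
    refine mul_right_cancel₀ hab ?_
    rw [hC, ← hnl]; ring)
  rw [eq_div_iff (mul_ne_zero hlam0 hβ')] at hθ
  rw [eq_div_iff (mul_ne_zero hlam0 hα')] at hφ
  have hP : ∀ ξ (a b : ℤ), trig A B C α β ξ = lam *
      ((β : ℂ) * (expTurn (α * ξ + θ - a) - 1) - α * (expTurn (β * ξ + φ - b) - 1)) := by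
    intro ξ a b
    rw [expTurn_sub_int, expTurn_sub_int, expTurn_add, expTurn_add, trig, ← hθ,
      show C = -(-C) by ring, ← hφ]
    have : A = lam * (α - β) := by rw [hlam]; field_simp
    linear_combination this
  obtain ⟨K, hK, hb⟩ := exists_degenerate_lower_bound hα hβ hαβ
  have hnl0 : 0 < ‖lam‖ := norm_pos_iff.2 hlam0
  have hα0 : 0 < |α| := abs_pos.2 hα
  refine ⟨‖lam‖ / (K * (1 + |α|⁻¹)), by positivity, θ, φ - β / α * θ, fun ξ a ha => ?_⟩
  obtain ⟨h1, h2⟩ := hb (α * ξ + θ - a) (β * ξ + φ - round (β * ξ + φ)) ha (abs_sub_round _)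
  rw [hP ξ a (round (β * ξ + φ)), norm_mul]
  set p := ‖(β : ℂ) * (expTurn (α * ξ + θ - a) - 1) -
    α * (expTurn (β * ξ + φ - round (β * ξ + φ)) - 1)‖ with hp
  have hp0 : 0 ≤ p := norm_nonneg _
  have h3 : distInt (β / α * a + (φ - β / α * θ)) ≤ |α|⁻¹ * (K * p) := by
    refine (distInt_le_abs_sub_int _ (round (β * ξ + φ))).trans ?_
    refine le_trans (le_of_eq ?_) (mul_le_mul_of_nonneg_left h2 (by positivity))
    rw [← abs_inv, ← abs_mul, ← abs_neg]
    congr 1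
    field_simp
    ring
  have hKp : 0 ≤ K * p := by positivity
  have hai : 0 ≤ |α|⁻¹ := by positivity
  constructor <;> rw [div_mul_eq_mul_div, div_le_iff₀ (by positivity), mul_assoc] <;>
    refine mul_le_mul_of_nonneg_left ?_ hnl0.le
  · nlinarith
  · nlinarith

/-- The points `r i + κ`, `0 ≤ i < n`, with `r` of exact denominator `n`, are spread over the
circle with spacing `1/n`. -/
theorem exists_injOn_le_distInt (r : ℚ) (κ : ℝ) : ∃ τ : ℕ → ℕ,
    Set.InjOn τ (Finset.range r.den) ∧ (∀ i, τ i < r.den) ∧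
    ∀ i, (min (τ i) (r.den - 1 - τ i) : ℕ) ≤ r.den * distInt (r * i + κ) := by
  set n := r.den with hn
  have hn0 : 0 < n := r.den_pos
  have hnR : (0 : ℝ) < n := by exact_mod_cast hn0
  have hnZ : (n : ℤ) ≠ 0 := by exact_mod_cast hn0.ne'
  set f : ℕ → ℤ := fun i => i * r.num + ⌊n * κ⌋ with hf
  have hnn : ∀ i, 0 ≤ f i % n := fun i => Int.emod_nonneg _ hnZ
  have hlt : ∀ i, f i % n < n := fun i => Int.emod_lt_of_pos _ (by exact_mod_cast hn0)
  refine ⟨fun i => (f i % n).toNat, ?_, fun i => ?_, fun i => ?_⟩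
  · intro i hi j hj hij
    simp only [Finset.coe_range, Set.mem_Iio] at hi hj
    have h1 : f i % n = f j % n := by
      have := congrArg (fun k : ℕ => (k : ℤ)) hij
      simpa only [Int.toNat_of_nonneg (hnn _)] using this
    have h2 : (n : ℤ) ∣ (i - j) * r.num := by
      have := Int.ModEq.dvd (show f j ≡ f i [ZMOD n] from h1.symm)
      rw [hf] at this
      convert this using 1
      ring
    have h3 : IsCoprime (n : ℤ) r.num := by
      rw [Int.isCoprime_iff_nat_coprime]
      simpa using r.reduced.symm
    have h4 : (n : ℤ) ∣ (i - j) := h3.dvd_of_dvd_mul_right h2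
    have h5 := Int.eq_zero_of_abs_lt_dvd h4 (by rw [abs_lt]; omega)
    omega
  · have := hlt i
    have := hnn i
    dsimp only
    omega
  · set t := (f i % n).toNat with ht
    have htZ : (t : ℤ) = f i % n := Int.toNat_of_nonneg (hnn i)
    have htn : t < n := by have := hlt i; omega
    set q := f i / n with hq
    have hfi : (f i : ℝ) = n * q + t := by
      have := Int.mul_ediv_add_emod (f i) n
      rw [← htZ] at this
      exact_mod_cast this.symm
    have hr : (r : ℝ) * n = r.num := by exact_mod_cast r.mul_den_eq_num
    have hx : n * ((r : ℝ) * i + κ) = n * q + t + Int.fract (n * κ) := by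
      rw [← hfi, hf]
      push_cast
      rw [← hr]
      have := Int.floor_add_fract (n * κ)
      linear_combination -this
    have hfr0 := Int.fract_nonneg (n * κ)
    have hfr1 := Int.fract_lt_one (n * κ)
    set k := round ((r : ℝ) * i + κ) with hk
    have hdist : n * distInt (r * i + κ) = |n * q + t + Int.fract (n * κ) - n * k| := by
      rw [← hx, ← mul_sub, abs_mul, abs_of_pos hnR, distInt]
    rw [hdist]
    have htn' : (t : ℝ) + 1 ≤ n := by exact_mod_cast htn
    rcases le_or_gt k q with h | h
    · have h' : (k : ℝ) ≤ q := by exact_mod_cast h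
      have hm : ((min t (n - 1 - t) : ℕ) : ℝ) ≤ t := by exact_mod_cast min_le_left _ _
      refine hm.trans (le_trans ?_ (le_abs_self _))
      nlinarith
    · have h' : (q : ℝ) + 1 ≤ k := by exact_mod_cast h
      have hm : ((min t (n - 1 - t) : ℕ) : ℝ) ≤ (n - 1 - t : ℕ) := by
        exact_mod_cast min_le_right _ _
      have hc : ((n - 1 - t : ℕ) : ℝ) = n - 1 - t := by
        rw [Nat.cast_sub (by omega), Nat.cast_sub (by omega)]; simp
      rw [hc] at hm
      refine hm.trans (le_trans ?_ (neg_le_abs _))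
      nlinarith

theorem sum_range_le_of_injOn {n : ℕ} {τ : ℕ → ℕ} (hτ : Set.InjOn τ (Finset.range n))
    (hlt : ∀ i, τ i < n) (F : ℕ → ENNReal) :
    ∑ i ∈ Finset.range n, F (min (τ i) (n - 1 - τ i)) ≤ 2 * ∑ t ∈ Finset.range n, F t := by
  have h1 : ∑ i ∈ Finset.range n, F (min (τ i) (n - 1 - τ i)) ≤
      ∑ t ∈ Finset.range n, F (min t (n - 1 - t)) := by
    rw [← Finset.sum_image (f := fun t => F (min t (n - 1 - t))) hτ]
    refine Finset.sum_le_sum_of_subset fun t ht => ?_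
    obtain ⟨i, -, rfl⟩ := Finset.mem_image.1 ht
    exact Finset.mem_range.2 (hlt i)
  refine h1.trans ?_
  calc _ ≤ ∑ t ∈ Finset.range n, (F t + F (n - 1 - t)) := by
        refine Finset.sum_le_sum fun t _ => ?_
        rcases min_choice t (n - 1 - t) with h | h <;> rw [h] <;> simp
    _ = _ := by
        rw [Finset.sum_add_distrib, Finset.sum_range_reflect, two_mul]

/-- A harmonic sum with its first two terms replaced by `K₁`. -/
theorem sum_harmonic_tail_le (K₁ : ENNReal) {K₂ : ℝ} (hK₂ : 0 ≤ K₂) {n : ℕ} (hn : 3 ≤ n) :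
    ∑ t ∈ Finset.range n, (if t ≤ 1 then K₁ else
      ENNReal.ofReal (K₂ / (Real.log n * (t - 1 : ℝ)))) ≤ 2 * K₁ + ENNReal.ofReal (2 * K₂) := by
  have hn3 : (3 : ℝ) ≤ n := by exact_mod_cast hn
  have hlog : 1 ≤ Real.log n := by
    rw [Real.le_log_iff_exp_le (by linarith)]
    linarith [Real.exp_one_lt_d9]
  obtain ⟨m, hm⟩ : ∃ m, n = m + 2 := ⟨n - 2, by omega⟩
  have hmlog : (∑ i ∈ Finset.range m, ((i : ℝ) + 1)⁻¹) ≤ 1 + Real.log n := by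
    have h1 := harmonic_le_one_add_log m
    rw [harmonic] at h1
    push_cast at h1
    refine h1.trans ?_
    rcases Nat.eq_zero_or_pos m with h | h
    · rw [h]; simp; linarith
    · have : (0 : ℝ) < m := by exact_mod_cast h
      gcongr
      omega
  set L := Real.log n with hL
  rw [hm, Finset.sum_range_succ', Finset.sum_range_succ']
  have e : ∀ t ∈ Finset.range m, (if t + 1 + 1 ≤ 1 then K₁ else
      ENNReal.ofReal (K₂ / (L * ((t + 1 + 1 : ℕ) - 1 : ℝ)))) =
      ENNReal.ofReal (K₂ / L * ((t : ℝ) + 1)⁻¹) := by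
    intro t _
    rw [if_neg (by omega)]
    congr 1
    push_cast
    rw [show (t : ℝ) + 1 + 1 - 1 = t + 1 by ring, div_mul_eq_div_div, div_eq_mul_inv (K₂ / L)]
  rw [Finset.sum_congr rfl e, ← ENNReal.ofReal_sum_of_nonneg (fun i _ => by positivity),
    ← Finset.mul_sum]
  simp only [zero_add, le_refl, if_true, zero_le_one]
  have h2 : K₂ / L * ∑ i ∈ Finset.range m, ((i : ℝ) + 1)⁻¹ ≤ 2 * K₂ := by
    calc _ ≤ K₂ / L * (1 + L) := by gcongr
      _ ≤ K₂ / L * (2 * L) := by gcongr; linarith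
      _ = _ := by field_simp
  calc _ ≤ ENNReal.ofReal (2 * K₂) + K₁ + K₁ := by gcongr
    _ = _ := by ring

/-- Among `n` consecutive integers `a`, all but boundedly many contribute the terms of a harmonic
sum divided by `log n`; for the exceptional ones only the quadratic lower bound is available, whose
logarithmic integral is finite. -/
theorem exists_lintegral_log_le_of_double_zero {A B C : ℂ} {α β : ℝ} (hα : 0 < α) (hβ : β ≠ 0)
    (hαβ : α ≠ β) (hA : A ≠ 0) (hB : ‖B‖ * |β - α| = |β| * ‖A‖)
    (hC : ‖C‖ * |β - α| = |α| * ‖A‖) {D : ℝ} (hD : 0 ≤ D) :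
    ∃ K : ENNReal, K < ⊤ ∧ ∀ r : ℚ, 3 ≤ r.den → |β / α - r| * (r.den : ℝ) ^ 2 ≤ 1 → ∀ x : ℝ,
      ∫⁻ ξ in Set.Icc x (x + r.den / α), ENNReal.ofReal
        (Real.log (1 + D / (r.den * Real.log r.den) / ‖trig A B C α β ξ‖)) ≤ K := by
  obtain ⟨c, hc, θ, κ, hP⟩ := exists_degenerate_trig_lower_bound hα.ne' hβ hαβ hA hB hC
  set K₁ : ENNReal := 2 * ∫⁻ t in Set.Ioc 0 (1 / (2 * α)),
    ENNReal.ofReal (Real.log (1 + D / (c * α ^ 2) / t ^ 2)) with hK₁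
  have hK₁top : K₁ < ⊤ := ENNReal.mul_lt_top (by simp)
    (setLIntegral_log_one_add_div_sq_lt_top (by positivity) (by positivity))
  set K₂ : ℝ := D / (c * α) with hK₂
  have hK₂0 : 0 ≤ K₂ := by positivity
  refine ⟨2 * (2 * (2 * K₁ + ENNReal.ofReal (2 * K₂))),
    ENNReal.mul_lt_top (by simp) (ENNReal.mul_lt_top (by simp)
      (ENNReal.add_lt_top.2 ⟨ENNReal.mul_lt_top (by simp) hK₁top, ENNReal.ofReal_lt_top⟩)),
    fun r hr hrβ x => ?_⟩
  set n := r.den with hn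
  have hn3 : (3 : ℝ) ≤ n := by exact_mod_cast hr
  have hn0 : (0 : ℝ) < n := by linarith
  have hlog : 1 ≤ Real.log n := by
    rw [Real.le_log_iff_exp_le hn0]
    linarith [Real.exp_one_lt_d9]
  set F : ℝ → ENNReal := fun ξ => ENNReal.ofReal
    (Real.log (1 + D / (n * Real.log n) / ‖trig A B C α β ξ‖)) with hF
  -- the interval on which the integer `a` is nearest to `αξ + θ`
  set lo : ℤ → ℝ := fun a => (a - 1 / 2 - θ) / α with hlo
  have hnear : ∀ (a : ℤ), ∀ ξ ∈ Set.Icc (lo a) (lo a + 1 / α), |α * ξ + θ - a| ≤ 1 / 2 := by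
    intro a ξ hξ
    have h1 := hξ.1
    have h2 := hξ.2
    simp only [hlo] at h1 h2
    rw [← add_div, le_div_iff₀ hα] at h2
    rw [div_le_iff₀ hα] at h1
    rw [abs_le]; constructor <;> linarith
  have hpt : ∀ {ξ b : ℝ}, 0 < b → b ≤ ‖trig A B C α β ξ‖ →
      F ξ ≤ ENNReal.ofReal (Real.log (1 + D / (n * Real.log n) / b)) := by
    intro ξ b hb h
    have : 0 < ‖trig A B C α β ξ‖ := hb.trans_le h
    refine ENNReal.ofReal_le_ofReal (Real.log_le_log (by positivity) ?_)
    gcongr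
  have hbad : ∀ a : ℤ, ∫⁻ ξ in Set.Icc (lo a) (lo a + 1 / α), F ξ ≤ K₁ := by
    intro a
    set z := (a - θ) / α with hz
    have hset : Set.Icc (lo a) (lo a + 1 / α) = Set.Icc (z - 1 / (2 * α)) (z + 1 / (2 * α)) := by
      congr 1 <;> simp only [hlo, hz] <;> field_simp <;> ring
    calc _ ≤ ∫⁻ ξ in Set.Icc (lo a) (lo a + 1 / α),
          ENNReal.ofReal (Real.log (1 + D / (c * α ^ 2) / |ξ - z| ^ 2)) := by
          have hne : ∀ᵐ ξ ∂volume.restrict (Set.Icc (lo a) (lo a + 1 / α)), ξ ≠ z :=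
            ae_restrict_of_ae (by simp [ae_iff])
          refine lintegral_mono_ae ?_
          filter_upwards [hne, ae_restrict_mem measurableSet_Icc] with ξ h1 h2
          have h3 : 0 < |ξ - z| := abs_pos.2 (sub_ne_zero.2 h1)
          have h4 := (hP ξ a (hnear a ξ h2)).1
          have h5 : α * ξ + θ - a = α * (ξ - z) := by rw [hz]; field_simp; ring
          rw [h5, mul_pow, ← sq_abs (ξ - z)] at h4
          refine (hpt (by positivity) h4).trans (ENNReal.ofReal_le_ofReal
            (Real.log_le_log (by positivity) ?_))
          have h6 : D / (n * Real.log n) ≤ D := div_le_self hD (by nlinarith)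
          rw [div_div D (c * α ^ 2), mul_assoc c]
          gcongr
      _ ≤ K₁ := by
          rw [hset]
          exact setLIntegral_abs_sub_le
            (fun t => ENNReal.ofReal (Real.log (1 + D / (c * α ^ 2) / t ^ 2))) z _
  have hgood : ∀ (a : ℤ) (s : ℝ), 0 < s → s ≤ n * distInt (β / α * a + κ) →
      ∫⁻ ξ in Set.Icc (lo a) (lo a + 1 / α), F ξ ≤ ENNReal.ofReal (K₂ / (Real.log n * s)) := by
    intro a s hs hsd
    have hs' : s / n ≤ distInt (β / α * a + κ) := by rwa [div_le_iff₀' hn0]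
    calc _ ≤ ∫⁻ ξ in Set.Icc (lo a) (lo a + 1 / α),
          ENNReal.ofReal (D / (c * (Real.log n * s))) := by
          refine setLIntegral_mono' measurableSet_Icc fun ξ hξ => ?_
          have h4 := (hP ξ a (hnear a ξ hξ)).2
          have h5 : c * (s / n) ≤ ‖trig A B C α β ξ‖ :=
            (mul_le_mul_of_nonneg_left hs' hc.le).trans h4
          refine (hpt (by positivity) h5).trans (ENNReal.ofReal_le_ofReal
            ((log_one_add_le_self (by positivity)).trans (le_of_eq ?_)))
          field_simp
      _ = _ := by
          rw [setLIntegral_const, Real.volume_Icc, ← ENNReal.ofReal_mul (by positivity)]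
          congr 1
          rw [hK₂]; field_simp; ring
  have hblock : ∀ a₀ : ℤ, ∫⁻ ξ in Set.Icc (lo a₀) (lo a₀ + n * (1 / α)), F ξ ≤
      2 * (2 * K₁ + ENNReal.ofReal (2 * K₂)) := by
    intro a₀
    obtain ⟨τ, hτ, hlt, hd⟩ := exists_injOn_le_distInt r (β / α * a₀ + κ)
    have hterm : ∀ i ∈ Finset.range n,
        ∫⁻ ξ in Set.Icc (lo a₀ + i * (1 / α)) (lo a₀ + i * (1 / α) + 1 / α), F ξ ≤
        (fun t : ℕ => if t ≤ 1 then K₁ else ENNReal.ofReal (K₂ / (Real.log n * (t - 1 : ℝ))))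
          (min (τ i) (n - 1 - τ i)) := by
      intro i hi
      have hi' : (i : ℝ) ≤ n := by exact_mod_cast (Finset.mem_range.1 hi).le
      have e : lo a₀ + i * (1 / α) = lo (a₀ + i) := by
        simp only [hlo]; push_cast; field_simp; ring
      rw [e]
      dsimp only
      split_ifs with h
      · exact hbad _
      · have h2 : 2 ≤ min (τ i) (n - 1 - τ i) := by omega
        have h2' : (2 : ℝ) ≤ (min (τ i) (n - 1 - τ i) : ℕ) := by exact_mod_cast h2
        refine hgood _ _ (by linarith) ?_
        have h3 := hd i
        have h4 := distInt_sub_abs_le (r * i + (β / α * a₀ + κ)) ((β / α - r) * i)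
        have h5 : r * i + (β / α * a₀ + κ) + (β / α - r) * i =
            β / α * ((a₀ + i : ℤ) : ℝ) + κ := by push_cast; ring
        have h6 : n * |(β / α - r) * i| ≤ 1 := by
          rw [abs_mul, abs_of_nonneg (Nat.cast_nonneg i : (0 : ℝ) ≤ i)]
          calc _ ≤ n * (|β / α - r| * n) := by gcongr
            _ = |β / α - r| * (n : ℝ) ^ 2 := by ring
            _ ≤ 1 := hrβ
        rw [h5] at h4
        have h7 := mul_le_mul_of_nonneg_left h4 hn0.le
        rw [mul_sub] at h7
        linarith
    calc _ ≤ _ := setLIntegral_Icc_nat_mul_le_sum F (1 / α) n (lo a₀)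
      _ ≤ _ := Finset.sum_le_sum hterm
      _ ≤ _ := sum_range_le_of_injOn hτ hlt
          (fun t => if t ≤ 1 then K₁ else ENNReal.ofReal (K₂ / (Real.log n * (t - 1 : ℝ))))
      _ ≤ _ := by gcongr; exact sum_harmonic_tail_le K₁ hK₂0 hr
  set a₀ := ⌊α * x + θ⌋ with ha₀
  have hsub : Set.Icc x (x + n / α) ⊆ Set.Icc (lo a₀) (lo a₀ + n * (1 / α)) ∪
      Set.Icc (lo (a₀ + n)) (lo (a₀ + n) + n * (1 / α)) := by
    intro ξ hξ
    have h1 : lo a₀ ≤ x := by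
      simp only [hlo]; rw [div_le_iff₀ hα]
      linarith [Int.floor_le (α * x + θ)]
    have h2 : x ≤ lo a₀ + (3 / 2) / α := by
      simp only [hlo]; rw [← add_div, le_div_iff₀ hα]
      linarith [Int.lt_floor_add_one (α * x + θ)]
    have h3 : lo (a₀ + n) = lo a₀ + n * (1 / α) := by
      simp only [hlo]; push_cast; field_simp; ring
    have h4 : 3 / 2 / α ≤ n * (1 / α) := by
      rw [mul_one_div]; gcongr; linarith
    have h5 : (n : ℝ) / α = n * (1 / α) := by ring
    have hξ1 := hξ.1
    have hξ2 := hξ.2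
    rw [h3]
    rcases le_total ξ (lo a₀ + n * (1 / α)) with h | h
    · exact Or.inl ⟨by linarith, h⟩
    · exact Or.inr ⟨h, by linarith⟩
  calc _ ≤ _ := lintegral_mono_set hsub
    _ ≤ _ := lintegral_union_le _ _ _
    _ ≤ _ := add_le_add (hblock a₀) (hblock (a₀ + n))
    _ = _ := (two_mul _).symm

/-- For a rational approximation of `β / α` with denominator `n`, the logarithmic defect caused by
an error `D / (n log n)` is bounded over intervals of length `n / α`. -/
theorem exists_lintegral_log_le {A B C : ℂ} {α β : ℝ} (hα : 0 < α) (hβ : β ≠ 0) (hαβ : α ≠ β)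
    (h : ¬ (A = 0 ∧ B = 0 ∧ C = 0)) {D : ℝ} (hD : 0 ≤ D) :
    ∃ K : ENNReal, K < ⊤ ∧ ∀ r : ℚ, 3 ≤ r.den → |β / α - r| * (r.den : ℝ) ^ 2 ≤ 1 → ∀ x : ℝ,
      ∫⁻ ξ in Set.Icc x (x + r.den / α), ENNReal.ofReal
        (Real.log (1 + D / (r.den * Real.log r.den) / ‖trig A B C α β ξ‖)) ≤ K := by
  by_cases hd : ‖B‖ * |β - α| = |β| * ‖A‖ ∧ ‖C‖ * |β - α| = |α| * ‖A‖
  · have hA : A ≠ 0 := by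
      rintro rfl
      have hab : |β - α| ≠ 0 := (abs_pos.2 (sub_ne_zero.2 hαβ.symm)).ne'
      simp only [norm_zero, mul_zero, mul_eq_zero, norm_eq_zero, hab, or_false] at hd
      exact h ⟨rfl, hd⟩
    exact exists_lintegral_log_le_of_double_zero hα hβ hαβ hA hd.1 hd.2 hD
  · obtain ⟨K, hK, hb⟩ := exists_lintegral_log_le_of_no_double_zero hα hd hD
    exact ⟨K, hK, fun r hr _ x => hb r.den hr x⟩

/-! ### The recurrence `G (ξ - 1) = p ξ * G ξ` -/

theorem tendsto_setLIntegral_Ici {f : ℝ → ENNReal} (hf : ∫⁻ x, f x ≠ ⊤) :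
    Tendsto (fun a : ℝ => ∫⁻ x in Set.Ici a, f x) atTop (nhds 0) := by
  have h : ∀ a : ℝ, ∫⁻ x in Set.Ici a, f x = volume.withDensity f (Set.Ici a) := fun a =>
    (withDensity_apply _ measurableSet_Ici).symm
  have hfin : volume.withDensity f Set.univ ≠ ⊤ := by simpa using hf
  simp_rw [h]
  have := tendsto_measure_iInter_atTop (μ := volume.withDensity f) (s := fun a : ℝ => Set.Ici a)
    (fun a => measurableSet_Ici.nullMeasurableSet) (fun a b hab => Set.Ici_subset_Ici.2 hab)
    ⟨0, ne_top_of_le_ne_top hfin (measure_mono (Set.subset_univ _))⟩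
  have he : ⋂ a : ℝ, Set.Ici a = ∅ := by
    ext x
    simp only [Set.mem_iInter, Set.mem_Ici, Set.mem_empty_iff_false, iff_false, not_forall]
    exact ⟨x + 1, by linarith⟩
  rwa [he, measure_empty] at this

theorem setLIntegral_comp_add (f : ℝ → ENNReal) (s : Set ℝ) (a : ℝ) :
    ∫⁻ x in (fun x => x + a) ⁻¹' s, f (x + a) = ∫⁻ x in s, f x :=
  (measurePreserving_add_right volume a).setLIntegral_comp_preimage_emb
    (measurableEmbedding_addRight a) f s

theorem setLIntegral_comp_neg (f : ℝ → ENNReal) (s : Set ℝ) :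
    ∫⁻ x in (fun x => -x) ⁻¹' s, f (-x) = ∫⁻ x in s, f x :=
  (Measure.measurePreserving_neg volume).setLIntegral_comp_preimage_emb
    (MeasurableEquiv.neg ℝ).measurableEmbedding f s

theorem lintegral_comp_neg (f : ℝ → ENNReal) : ∫⁻ x, f (-x) = ∫⁻ x, f x := by
  simpa using setLIntegral_comp_neg f Set.univ

/-- An integrable function tends to zero along almost every arithmetic progression of step `1`. -/
theorem ae_tendsto_comp_add_nat {f : ℝ → ENNReal} (hfm : Measurable f) (hf : ∫⁻ x, f x ≠ ⊤) :
    ∀ᵐ x : ℝ, Tendsto (fun k : ℕ => f (x + k)) atTop (nhds 0) := by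
  have hr : ∀ r : ℤ, ∀ᵐ x ∂volume.restrict (Set.Ico (r : ℝ) (r + 1)),
      Tendsto (fun k : ℕ => f (x + k)) atTop (nhds 0) := by
    intro r
    have hdisj : Pairwise (Function.onFun Disjoint
        fun k : ℕ => Set.Ico ((r : ℝ) + (k : ℤ)) (r + (k : ℤ) + 1)) := fun i j hij =>
      Set.pairwise_disjoint_Ico_add_intCast (r : ℝ) (by exact_mod_cast hij)
    have h1 : ∫⁻ x in Set.Ico (r : ℝ) (r + 1), ∑' k : ℕ, f (x + k) ≤ ∫⁻ x, f x := by
      rw [lintegral_tsum (f := fun (k : ℕ) x => f (x + k))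
        (fun k => (hfm.comp (measurable_add_const _)).aemeasurable)]
      calc _ = ∑' k : ℕ, ∫⁻ x in Set.Ico ((r : ℝ) + (k : ℤ)) (r + (k : ℤ) + 1), f x := by
            congr 1; ext k
            rw [← setLIntegral_comp_add f _ (k : ℝ)]
            congr 2
            ext x
            simp only [Set.mem_Ico, Set.mem_preimage, Int.cast_natCast]
            constructor <;> rintro ⟨h1, h2⟩ <;> constructor <;> linarith
        _ = ∫⁻ x in ⋃ k : ℕ, Set.Ico ((r : ℝ) + (k : ℤ)) (r + (k : ℤ) + 1), f x :=
            (lintegral_iUnion (fun _ => measurableSet_Ico) hdisj f).symm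
        _ ≤ _ := setLIntegral_le_lintegral _ _
    have h2 := ae_lt_top (Measurable.tsum fun k : ℕ =>
      hfm.comp (measurable_add_const (k : ℝ))) (ne_top_of_le_ne_top hf h1)
    filter_upwards [h2] with x hx
    exact ENNReal.tendsto_atTop_zero_of_tsum_ne_top hx.ne
  have h := (ae_restrict_iUnion_iff (fun r : ℤ => Set.Ico (r : ℝ) (r + 1))
    (fun x => Tendsto (fun k : ℕ => f (x + k)) atTop (nhds 0))).2 hr
  rwa [iUnion_Ico_intCast, Measure.restrict_univ] at h

theorem ae_tendsto_comp_sub_nat {f : ℝ → ENNReal} (hfm : Measurable f) (hf : ∫⁻ x, f x ≠ ⊤) :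
    ∀ᵐ x : ℝ, Tendsto (fun k : ℕ => f (x - k)) atTop (nhds 0) := by
  have h := ae_tendsto_comp_add_nat (hfm.comp measurable_neg)
    (by simpa only [Function.comp_apply, lintegral_comp_neg] using hf)
  filter_upwards [(Measure.measurePreserving_neg (volume : Measure ℝ)).quasiMeasurePreserving.ae h]
    with x hx
  convert hx using 3
  simp only [Function.comp_apply]
  congr 1
  ring

theorem ae_orbit {q : ℝ → Prop} (h : ∀ᵐ x : ℝ, q x) : ∀ᵐ x : ℝ, ∀ k : ℕ, q (x - k) :=
  ae_all_iff.2 fun k => (quasiMeasurePreserving_sub_right (k : ℝ)).ae h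

/-- If `G (x - 1) = p x * G x` along the orbits of `ξ` and `ξ + T`, and `p` increases by at most
`δ` under translation by `T`, then the values of `G` at the ends of two stretches of length `N`
control those at the other ends. -/
theorem mul_le_mul_exp_sum_log {G p : ℝ → ℝ} (hG : ∀ x, 0 ≤ G x) {ξ T δ : ℝ} (hδ : 0 ≤ δ)
    (hp : ∀ k : ℕ, 0 < p (ξ - k)) (hξ : ∀ k : ℕ, G (ξ - k - 1) = p (ξ - k) * G (ξ - k))
    (hξT : ∀ k : ℕ, G (ξ + T - k - 1) = p (ξ + T - k) * G (ξ + T - k))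
    (N : ℕ) (hpT : ∀ k < N, p (ξ - k + T) ≤ p (ξ - k) + δ) :
    G ξ * G (ξ + T - N) ≤ G (ξ - N) * G (ξ + T) *
      Real.exp (∑ k ∈ Finset.range N, Real.log (1 + δ / p (ξ - k))) := by
  induction N with
  | zero => simp
  | succ N ih =>
    have ih := ih fun k hk => hpT k (hk.trans (Nat.lt_succ_self N))
    have hpN := hp N
    have e1 : G (ξ - (N + 1 : ℕ)) = p (ξ - N) * G (ξ - N) := by
      rw [← hξ]; congr 1; push_cast; ring
    have e2 : G (ξ + T - (N + 1 : ℕ)) = p (ξ + T - N) * G (ξ + T - N) := by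
      rw [← hξT]; congr 1; push_cast; ring
    have e3 : p (ξ + T - N) ≤ p (ξ - N) * (1 + δ / p (ξ - N)) := by
      have := hpT N (Nat.lt_succ_self N)
      rw [mul_add, mul_one, mul_div_cancel₀ _ hpN.ne']
      convert this using 2; ring
    rw [e1, e2, Finset.sum_range_succ, Real.exp_add, Real.exp_log (by positivity)]
    calc G ξ * (p (ξ + T - N) * G (ξ + T - N))
        = p (ξ + T - N) * (G ξ * G (ξ + T - N)) := by ring
      _ ≤ (p (ξ - N) * (1 + δ / p (ξ - N))) * (G (ξ - N) * G (ξ + T) *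
          Real.exp (∑ k ∈ Finset.range N, Real.log (1 + δ / p (ξ - k)))) :=
          mul_le_mul e3 ih (mul_nonneg (hG _) (hG _)) (by positivity)
      _ = _ := by ring

theorem sum_setLIntegral_comp_sub_le (F : ℝ → ENNReal) (r : ℝ) (N : ℕ) :
    ∑ k ∈ Finset.range N, ∫⁻ x in Set.Ico r (r + 1), F (x - k) ≤
      ∫⁻ x in Set.Icc (r + 1 - N) (r + 1 - N + N), F x := by
  have h : ∑ k ∈ Finset.range N, ∫⁻ x in Set.Ico r (r + 1), F (x - k) =
      ∫⁻ x in Set.Ico (r + 1 - N) (r + 1), F x := by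
    induction N with
    | zero => simp
    | succ N ih =>
      have e : ∫⁻ x in Set.Ico r (r + 1), F (x - N) =
          ∫⁻ x in Set.Ico (r + 1 - (N + 1 : ℕ)) (r + 1 - N), F x := by
        rw [← setLIntegral_comp_add F _ (-(N : ℝ))]
        simp_rw [← sub_eq_add_neg]
        congr 2
        ext x
        simp only [Set.mem_Ico, Set.mem_preimage]
        push_cast
        constructor <;> rintro ⟨h1, h2⟩ <;> constructor <;> linarith
      have hu := Set.Ico_union_Ico_eq_Ico (a := r + 1 - (N + 1 : ℕ)) (b := r + 1 - N) (c := r + 1)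
        (by push_cast; linarith) (by simp)
      rw [Finset.sum_range_succ, ih, e, ← hu,
        lintegral_union measurableSet_Ico Set.Ico_disjoint_Ico_same, add_comm]
  rw [h]
  refine lintegral_mono_set fun x hx => ⟨hx.1, ?_⟩
  linarith [hx.2]

open scoped Pointwise in
/-- A square integrable solution of `G (ξ - 1) = p ξ * G ξ` vanishes if `p` has arbitrarily large
approximate almost periods `T`, close to integers `N`, along which the total logarithmic defect
stays bounded in mean. -/
theorem ae_eq_zero_of_almost_periodic {G p : ℝ → ℝ} (hG : ∀ x, 0 ≤ G x) (hGm : Measurable G)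
    (hG2 : ∫⁻ x, ENNReal.ofReal (G x ^ 2) ≠ ⊤) (hpm : Measurable p) (hp : ∀ᵐ x : ℝ, 0 < p x)
    (hrec : ∀ᵐ x : ℝ, G (x - 1) = p x * G x)
    (H : ∀ σ₀ > (0 : ℝ), ∃ K : ENNReal, K < ⊤ ∧ ∀ M : ℝ, ∃ T ≥ M, ∃ N : ℕ, |T - N| < σ₀ ∧
      ∃ δ ≥ 0, (∀ x, p (x + T) ≤ p x + δ) ∧
        ∀ x : ℝ, ∫⁻ ξ in Set.Icc x (x + N), ENNReal.ofReal (Real.log (1 + δ / p ξ)) ≤ K) :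
    ∀ᵐ x : ℝ, G x = 0 := by
  by_contra hne
  set f : ℝ → ENNReal := fun x => ENNReal.ofReal (G x ^ 2) with hf
  have hfm : Measurable f := by fun_prop
  -- a compact set of positive measure on which `G` is bounded below
  obtain ⟨r, ε, hε, hpos⟩ : ∃ r : ℤ, ∃ ε > (0 : ℝ),
      0 < volume ({x | ε < G x} ∩ Set.Ico (r : ℝ) (r + 1)) := by
    by_contra! h
    apply hne
    have h1 : ∀ r : ℤ, ∀ m : ℕ, ∀ᵐ x : ℝ, x ∉ {x | 1 / ((m : ℝ) + 1) < G x} ∩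
        Set.Ico (r : ℝ) (r + 1) := fun r m =>
      measure_eq_zero_iff_ae_notMem.1 (le_antisymm (h r _ (by positivity)) zero_le)
    filter_upwards [ae_all_iff.2 fun r => ae_all_iff.2 (h1 r)] with x hx
    by_contra hx0
    obtain ⟨m, hm⟩ := exists_nat_one_div_lt (lt_of_le_of_ne (hG x) (Ne.symm hx0))
    exact hx ⌊x⌋ m ⟨hm, Int.floor_le x, Int.lt_floor_add_one x⟩
  obtain ⟨K, hKsub, hKc, hK0⟩ := ((measurableSet_lt measurable_const hGm).inter
    measurableSet_Ico).exists_lt_isCompact hpos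
  have hKm : MeasurableSet K := hKc.isClosed.measurableSet
  set m := volume K with hm
  have hmtop : m ≠ ⊤ := hKc.measure_lt_top.ne
  have hm4 : m / 4 ≠ 0 := (ENNReal.div_pos hK0.ne' (by simp)).ne'
  -- small translates of `K` nearly fill `K`
  obtain ⟨σ₀, hσ₀, hσ⟩ := Metric.eventually_nhds_iff.1
    (eventually_nhds_zero_measure_vadd_sdiff_lt (μ := volume) hKc hKc.isClosed hm4)
  obtain ⟨C, hC, HC⟩ := H σ₀ hσ₀
  set lam : ENNReal := C / (m / 4) + 1 with hlam
  have hlamtop : lam ≠ ⊤ :=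
    ENNReal.add_ne_top.2 ⟨(ENNReal.div_lt_top hC.ne hm4).ne, ENNReal.one_ne_top⟩
  have hlam0 : lam ≠ 0 := (lt_of_lt_of_le one_pos le_add_self).ne'
  set b : ℝ := ε ^ 2 * Real.exp (-lam.toReal) with hb
  have hb0 : 0 < b := by positivity
  have hb0' : ENNReal.ofReal b ≠ 0 := by simpa using hb0
  set η : ENNReal := m / 8 * ENNReal.ofReal b with hη
  have hη0 : 0 < η := ENNReal.mul_pos (ENNReal.div_pos hK0.ne' (by simp)).ne' hb0'
  have hfneg : ∫⁻ x, f (-x) ≠ ⊤ := by rwa [lintegral_comp_neg]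
  obtain ⟨R₁, hR₁⟩ := eventually_atTop.1 ((tendsto_setLIntegral_Ici hG2).eventually_lt_const hη0)
  obtain ⟨R₂, hR₂⟩ := eventually_atTop.1 ((tendsto_setLIntegral_Ici hfneg).eventually_lt_const hη0)
  obtain ⟨T, hT, N, hTN, δ, hδ, hpT, hint⟩ := HC (max (R₁ - r) (R₂ + r + 1 + σ₀))
  have hT1 : R₁ ≤ r + T := by linarith [(le_max_left _ _).trans hT]
  have hT2 : R₂ ≤ N - r - 1 := by
    linarith [(le_max_right _ _).trans hT, (abs_lt.1 hTN).2]
  set bad₁ : Set ℝ := {x | x ∈ K ∧ x + (T - N) ∉ K} with hbad₁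
  set S : ℝ → ENNReal := fun x =>
    ∑ k ∈ Finset.range N, ENNReal.ofReal (Real.log (1 + δ / p (x - k))) with hS
  have hSm : Measurable S := by fun_prop
  set Ψ : ℝ → ENNReal := fun x => f (x - N) + f (x + T) with hΨ
  have hΨm : Measurable Ψ := by fun_prop
  have h₁ : volume bad₁ < m / 4 := by
    have h := hσ (y := T - N) (by simpa using hTN)
    have e : bad₁ = (fun x => (T - N) + x) ⁻¹' (((T - N) +ᵥ K) \ K) := by
      ext x
      simp only [hbad₁, Set.mem_ofPred_eq, Set.mem_preimage, Set.mem_sdiff, add_comm x]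
      refine and_congr_left fun _ => ?_
      rw [← vadd_eq_add, Set.vadd_mem_vadd_set_iff]
    rwa [e, measure_preimage_add]
  have h₂ : volume.restrict K {x | lam ≤ S x} ≤ m / 4 := by
    refine (meas_ge_le_lintegral_div hSm.aemeasurable hlam0 hlamtop).trans ?_
    have h1 : ∫⁻ x in K, S x ≤ C := by
      calc _ ≤ ∫⁻ x in Set.Ico (r : ℝ) (r + 1), S x :=
            lintegral_mono_set (hKsub.trans Set.inter_subset_right)
        _ = ∑ k ∈ Finset.range N, ∫⁻ x in Set.Ico (r : ℝ) (r + 1),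
              ENNReal.ofReal (Real.log (1 + δ / p (x - k))) :=
            lintegral_finsetSum _ fun k _ => by fun_prop
        _ ≤ _ := sum_setLIntegral_comp_sub_le
            (fun x => ENNReal.ofReal (Real.log (1 + δ / p x))) r N
        _ ≤ C := hint _
    refine ENNReal.div_le_of_le_mul (h1.trans ?_)
    have h4top : m / 4 ≠ ⊤ := (ENNReal.div_lt_top hmtop (by simp)).ne
    rw [hlam, mul_add, ENNReal.mul_div_cancel hm4 h4top]
    exact le_self_add
  have h₃ : volume.restrict K {x | ENNReal.ofReal b ≤ Ψ x} ≤ m / 4 := by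
    refine (meas_ge_le_lintegral_div hΨm.aemeasurable hb0' ENNReal.ofReal_ne_top).trans ?_
    have hKr : ∀ x ∈ K, (r : ℝ) ≤ x ∧ x < r + 1 := fun x hx => (hKsub hx).2
    have h1 : ∫⁻ x in K, f (x + T) ≤ η := by
      calc _ ≤ ∫⁻ x in (fun x => x + T) ⁻¹' Set.Ici (r + T), f (x + T) :=
            lintegral_mono_set fun x hx => by simpa using (hKr x hx).1
        _ = _ := setLIntegral_comp_add f _ T
        _ ≤ η := (hR₁ _ hT1).le
    have h2 : ∫⁻ x in K, f (x - N) ≤ η := by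
      calc _ ≤ ∫⁻ x in (fun x => x + -(N : ℝ)) ⁻¹' Set.Iic (r + 1 - N), f (x + -(N : ℝ)) := by
            simp_rw [← sub_eq_add_neg]
            exact lintegral_mono_set fun x hx => by simpa using (hKr x hx).2.le
        _ = ∫⁻ x in Set.Iic (r + 1 - N : ℝ), f x := setLIntegral_comp_add f _ _
        _ = ∫⁻ x in (fun x => -x) ⁻¹' Set.Iic (r + 1 - N : ℝ), f (-x) :=
            (setLIntegral_comp_neg f _).symm
        _ = ∫⁻ x in Set.Ici (N - r - 1 : ℝ), f (-x) := by
            congr 2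
            ext x
            simp only [Set.mem_preimage, Set.mem_Iic, Set.mem_Ici]
            constructor <;> intro h <;> linarith
        _ ≤ η := (hR₂ _ hT2).le
    refine ENNReal.div_le_of_le_mul ?_
    calc ∫⁻ x in K, Ψ x = (∫⁻ x in K, f (x - N)) + ∫⁻ x in K, f (x + T) :=
          lintegral_add_left (by fun_prop) _
      _ ≤ η + η := add_le_add h2 h1
      _ = 2 * (m / 8) * ENNReal.ofReal b := by rw [hη]; ring
      _ = m / 4 * ENNReal.ofReal b := by
          congr 1
          rw [div_eq_mul_inv, div_eq_mul_inv, mul_left_comm]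
          congr 1
          rw [show (8 : ENNReal) = 2 * 4 by norm_num, ENNReal.mul_inv (by simp) (by simp),
            ← mul_assoc, ENNReal.mul_inv_cancel (by simp) (by simp), one_mul]
  have horb := ae_orbit (hp.and hrec)
  have horbT : ∀ᵐ x : ℝ, ∀ k : ℕ, G (x + T - k - 1) = p (x + T - k) * G (x + T - k) :=
    (measurePreserving_add_right volume T).quasiMeasurePreserving.ae (ae_orbit hrec)
  have hcover : ∀ᵐ x : ℝ, x ∈ K → x ∈ bad₁ ∪ ({x | lam ≤ S x} ∩ K ∪
      {x | ENNReal.ofReal b ≤ Ψ x} ∩ K) := by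
    filter_upwards [horb, horbT] with x hx hxT hxK
    by_contra hgood
    simp only [Set.mem_union, Set.mem_inter_iff, hxK, and_true, not_or, hbad₁, Set.mem_ofPred_eq,
      true_and, not_not, not_le] at hgood
    obtain ⟨g1, g2, g3⟩ := hgood
    have key := mul_le_mul_exp_sum_log hG hδ (fun k => (hx k).1) (fun k => (hx k).2) hxT N
      (fun k _ => hpT _)
    have hx1 : ε < G x := (hKsub hxK).1
    have hx2 : ε < G (x + T - N) := by
      rw [add_sub_assoc]; exact (hKsub g1).1
    have hsum : ∑ k ∈ Finset.range N, Real.log (1 + δ / p (x - k)) ≤ lam.toReal := by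
      have hnn : ∀ k ∈ Finset.range N, 0 ≤ Real.log (1 + δ / p (x - k)) := fun k _ =>
        log_one_add_nonneg (div_nonneg hδ (hx k).1.le)
      have h5 := g2.le
      rw [hS] at h5
      dsimp only at h5
      rw [← ENNReal.ofReal_sum_of_nonneg hnn] at h5
      exact (ENNReal.ofReal_le_iff_le_toReal hlamtop).1 h5
    have h6 : ε ^ 2 ≤ G (x - N) * G (x + T) * Real.exp lam.toReal := by
      calc ε ^ 2 ≤ G x * G (x + T - N) := by nlinarith
        _ ≤ _ := key
        _ ≤ _ := mul_le_mul_of_nonneg_left (Real.exp_le_exp.2 hsum)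
            (mul_nonneg (hG _) (hG _))
    have h7 : b ≤ G (x - N) * G (x + T) := by
      rw [hb, Real.exp_neg, ← div_eq_mul_inv, div_le_iff₀ (Real.exp_pos _)]
      exact h6
    have h8 : ENNReal.ofReal b ≤ Ψ x := by
      rw [hΨ, hf]
      dsimp only
      rw [← ENNReal.ofReal_add (sq_nonneg _) (sq_nonneg _)]
      refine ENNReal.ofReal_le_ofReal (h7.trans ?_)
      nlinarith [sq_nonneg (G (x - N) - G (x + T)), sq_nonneg (G (x - N) + G (x + T))]
    exact absurd h8 (not_le.2 g3)
  have hfinal : m ≤ volume bad₁ + (m / 4 + m / 4) := by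
    calc m ≤ volume (bad₁ ∪ ({x | lam ≤ S x} ∩ K ∪ {x | ENNReal.ofReal b ≤ Ψ x} ∩ K)) :=
          measure_mono_ae hcover
      _ ≤ _ := (measure_union_le _ _).trans (add_le_add le_rfl
          ((measure_union_le _ _).trans (add_le_add ?_ ?_)))
    · rwa [Measure.restrict_apply' hKm] at h₂
    · rwa [Measure.restrict_apply' hKm] at h₃
  have h4top : m / 4 ≠ ⊤ := (ENNReal.div_lt_top hmtop (by simp)).ne
  have hlt : volume bad₁ + (m / 4 + m / 4) < m / 4 + (m / 4 + m / 4) :=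
    ENNReal.add_lt_add_right (ENNReal.add_ne_top.2 ⟨h4top, h4top⟩) h₁
  have hle : m / 4 + (m / 4 + m / 4) ≤ m := by
    have : m / 4 + (m / 4 + m / 4) + m / 4 = m := by
      rw [show m / 4 + (m / 4 + m / 4) + m / 4 = 4 * (m / 4) by ring]
      exact ENNReal.mul_div_cancel (by simp) (by simp)
    calc _ ≤ _ := le_self_add
      _ = m := this
  exact absurd (hfinal.trans_lt hlt) (not_lt.2 hle)

/-! ### Recurrences driven by trigonometric polynomials -/

/-- The only nonnegative square integrable solution of `G (ξ - 1) = p ξ * G ξ` is zero. -/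
def OnlyZeroSolution (p : ℝ → ℝ) : Prop :=
  ∀ G : ℝ → ℝ, (∀ x, 0 ≤ G x) → Measurable G → ∫⁻ x, ENNReal.ofReal (G x ^ 2) ≠ ⊤ →
    (∀ᵐ x : ℝ, G (x - 1) = p x * G x) → ∀ᵐ x : ℝ, G x = 0

theorem distInt_int (k : ℤ) : distInt k = 0 := by simp [distInt]

theorem distInt_nat (k : ℕ) : distInt k = 0 := distInt_int k

/-- Dirichlet's theorem: a bounded multiple of any `T ≥ 0` is within `σ₀` of a natural number. -/
theorem exists_nat_mul_near_nat {σ₀ : ℝ} (hσ₀ : 0 < σ₀) : ∃ J : ℕ, ∀ T : ℝ, 0 ≤ T →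
    ∃ j : ℕ, 0 < j ∧ j ≤ J ∧ ∃ N : ℕ, |j * T - N| < σ₀ := by
  obtain ⟨J, hJ⟩ := exists_nat_one_div_lt hσ₀
  refine ⟨J + 1, fun T hT => ?_⟩
  obtain ⟨j, hj0, hjJ, hj⟩ := Real.exists_nat_abs_mul_sub_round_le T (n := J + 1) (by omega)
  have hr : 0 ≤ round (j * T) := by
    rw [round_eq]
    exact Int.floor_nonneg.2 (by positivity)
  refine ⟨j, hj0, hjJ, (round (j * T)).toNat, ?_⟩
  have e : (((round (j * T)).toNat : ℕ) : ℝ) = (round (j * T) : ℝ) := by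
    exact_mod_cast congrArg (Int.cast : ℤ → ℝ) (Int.toNat_of_nonneg hr)
  rw [e]
  refine hj.trans_lt (lt_of_le_of_lt ?_ hJ)
  push_cast
  exact one_div_le_one_div_of_le (by positivity) (by linarith)

theorem le_comp_nat_mul_add {p : ℝ → ℝ} {T₀ : ℝ} (h : ∀ x, p (x + T₀) ≤ p x) (n : ℕ) (x : ℝ) :
    p (x + n * T₀) ≤ p x := by
  induction n with
  | zero => simp
  | succ n ih =>
    refine le_trans (le_of_eq ?_) ((h (x + n * T₀)).trans ih)
    congr 1; push_cast; ring

theorem onlyZeroSolution_of_periodic {p : ℝ → ℝ} (hpm : Measurable p) (hp : ∀ᵐ x : ℝ, 0 < p x)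
    {T₀ : ℝ} (hT₀ : 0 < T₀) (hper : ∀ x, p (x + T₀) ≤ p x) : OnlyZeroSolution p := by
  intro G hG hGm hG2 hrec
  refine ae_eq_zero_of_almost_periodic hG hGm hG2 hpm hp hrec fun σ₀ hσ₀ => ⟨0, by simp, fun M => ?_⟩
  obtain ⟨J, hJ⟩ := exists_nat_mul_near_nat hσ₀
  obtain ⟨n, hn⟩ := exists_nat_ge (M / T₀)
  rw [div_le_iff₀ hT₀] at hn
  obtain ⟨j, hj0, -, N, hN⟩ := hJ (n * T₀) (by positivity)
  have hj1 : (1 : ℝ) ≤ j := by exact_mod_cast hj0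
  refine ⟨j * (n * T₀), ?_, N, hN, 0, le_rfl, fun x => ?_, fun x => by simp⟩
  · have : 0 ≤ n * T₀ := by positivity
    nlinarith
  · have := le_comp_nat_mul_add hper (j * n) x
    push_cast at this
    rw [add_zero, ← mul_assoc]
    exact this

theorem ae_norm_trig_pos {A B C : ℂ} {α β : ℝ} (hα : α ≠ 0) (hβ : β ≠ 0) (hαβ : α ≠ β)
    (h : ¬ (A = 0 ∧ B = 0 ∧ C = 0)) : ∀ᵐ ξ : ℝ, 0 < ‖trig A B C α β ξ‖ := by
  filter_upwards [ae_trig_ne_zero hα hβ hαβ h] with ξ hξ using norm_pos_iff.2 hξ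

theorem measurable_norm_trig (A B C : ℂ) (α β : ℝ) : Measurable fun ξ => ‖trig A B C α β ξ‖ :=
  (continuous_trig A B C α β).norm.measurable

theorem onlyZeroSolution_trig_of_distInt_eq_zero {A B C : ℂ} {α β : ℝ} (hα : α ≠ 0) (hβ : β ≠ 0)
    (hαβ : α ≠ β) (h : ¬ (A = 0 ∧ B = 0 ∧ C = 0)) {T₀ : ℝ} (hT₀ : 0 < T₀)
    (hB : ‖B‖ * distInt (α * T₀) = 0) (hC : ‖C‖ * distInt (β * T₀) = 0) :
    OnlyZeroSolution fun ξ => ‖trig A B C α β ξ‖ := by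
  refine onlyZeroSolution_of_periodic (measurable_norm_trig _ _ _ _ _)
    (ae_norm_trig_pos hα hβ hαβ h) hT₀ fun x => ?_
  have := norm_trig_add_le A B C α β x T₀
  rwa [hB, hC, add_zero, mul_zero, add_zero] at this

theorem distInt_mul_div_abs {a : ℝ} (ha : a ≠ 0) (n : ℕ) : distInt (a * (n / |a|)) = 0 := by
  rcases lt_or_gt_of_ne ha with h | h
  · rw [abs_of_neg h, show a * (n / -a) = ((-n : ℤ) : ℝ) by push_cast; field_simp, distInt_int]
  · rw [abs_of_pos h, show a * (n / a) = n by field_simp, distInt_nat]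

theorem onlyZeroSolution_trig_of_ratio_rational {A B C : ℂ} {α β : ℝ} (hα : α ≠ 0) (hβ : β ≠ 0)
    (hαβ : α ≠ β) (h : ¬ (A = 0 ∧ B = 0 ∧ C = 0)) {r : ℚ} (hr : (r : ℝ) = β / α) :
    OnlyZeroSolution fun ξ => ‖trig A B C α β ξ‖ := by
  have hden : (0 : ℝ) < r.den := by exact_mod_cast r.den_pos
  have hβr : β = r * α := by rw [hr]; field_simp
  have hnum : (r : ℝ) * r.den = r.num := by exact_mod_cast r.mul_den_eq_num
  refine onlyZeroSolution_trig_of_distInt_eq_zero hα hβ hαβ h (T₀ := r.den / |α|)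
    (div_pos hden (abs_pos.2 hα)) (by rw [distInt_mul_div_abs hα, mul_zero]) ?_
  have e : distInt (β * (r.den / |α|)) = 0 := by
    rcases lt_or_gt_of_ne hα with h | h
    · rw [abs_of_neg h, show β * (r.den / -α) = ((-r.num : ℤ) : ℝ) by
        push_cast; rw [← hnum]; nth_rewrite 1 [hβr]; field_simp, distInt_int]
    · rw [abs_of_pos h, show β * (r.den / α) = (r.num : ℝ) by
        rw [← hnum]; nth_rewrite 1 [hβr]; field_simp, distInt_int]
  rw [e, mul_zero]

/-- The almost periods are `j n / α`, with `n` the denominator of a rational approximation of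
`β / α` and `j` a bounded factor that brings them close to the integers. -/
theorem onlyZeroSolution_trig_of_approx_of_pos {A B C : ℂ} {α β : ℝ} (hα : 0 < α) (hβ : β ≠ 0)
    (hαβ : α ≠ β) (h : ¬ (A = 0 ∧ B = 0 ∧ C = 0)) {c : ℝ}
    (happ : ∀ n₀ : ℕ, ∃ r : ℚ, n₀ ≤ r.den ∧
      |β / α - r| * ((r.den : ℝ) ^ 2 * Real.log r.den) ≤ c) :
    OnlyZeroSolution fun ξ => ‖trig A B C α β ξ‖ := by
  intro G hG hGm hG2 hrec
  have hc : 0 ≤ c := by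
    obtain ⟨r, -, hr⟩ := happ 0
    have := Real.log_natCast_nonneg r.den
    exact le_trans (by positivity) hr
  refine ae_eq_zero_of_almost_periodic hG hGm hG2 (measurable_norm_trig A B C α β)
    (ae_norm_trig_pos hα.ne' hβ hαβ h) hrec fun σ₀ hσ₀ => ?_
  obtain ⟨J, hJ⟩ := exists_nat_mul_near_nat hσ₀
  set D : ℝ := 2 * Real.pi * ‖C‖ * J * c with hD
  have hD0 : 0 ≤ D := by positivity
  obtain ⟨K, hK, hint⟩ := exists_lintegral_log_le hα hβ hαβ h hD0
  refine ⟨(J + 1 : ℕ) * K, ENNReal.mul_lt_top (by simp) hK, fun M => ?_⟩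
  obtain ⟨n₀, hn₀⟩ := exists_nat_ge (max (max 3 (α * M)) (max (α * σ₀) (Real.exp c)))
  obtain ⟨r, hr, hrc⟩ := happ n₀
  set n := r.den with hn
  have hmax : max (max 3 (α * M)) (max (α * σ₀) (Real.exp c)) ≤ n :=
    hn₀.trans (by exact_mod_cast hr)
  simp only [max_le_iff] at hmax
  obtain ⟨⟨hn3, hnM⟩, hnσ, hnc⟩ := hmax
  have hn0 : (0 : ℝ) < n := by linarith
  have hlogc : c ≤ Real.log n := (Real.le_log_iff_exp_le hn0).2 hnc
  have hlog1 : 1 ≤ Real.log n := by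
    rw [Real.le_log_iff_exp_le hn0]
    linarith [Real.exp_one_lt_d9]
  have hlog0 : 0 < Real.log n := by linarith
  have happr : |β / α - r| ≤ c / (n ^ 2 * Real.log n) := by
    rwa [le_div_iff₀ (by positivity)]
  have happr1 : |β / α - r| * (n : ℝ) ^ 2 ≤ 1 := by
    have : |β / α - r| * (n : ℝ) ^ 2 * Real.log n ≤ 1 * Real.log n := by linarith
    exact le_of_mul_le_mul_right this hlog0
  obtain ⟨j, hj0, hjJ, N, hN⟩ := hJ (n / α) (by positivity)
  have hj1 : (1 : ℝ) ≤ j := by exact_mod_cast hj0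
  have hjJ' : (j : ℝ) ≤ J := by exact_mod_cast hjJ
  have hnα : 0 ≤ n / α := by positivity
  refine ⟨j * (n / α), ?_, N, hN, D / (n * Real.log n), by positivity, fun x => ?_, fun x => ?_⟩
  · have : M ≤ n / α := by rw [le_div_iff₀ hα]; linarith
    nlinarith
  · refine (norm_trig_add_le A B C α β x (j * (n / α))).trans (add_le_add le_rfl ?_)
    have e1 : α * (j * (n / α)) = ((j * n : ℕ) : ℝ) := by push_cast; field_simp
    have hnum : (r : ℝ) * n = r.num := by exact_mod_cast r.mul_den_eq_num
    have e2 : distInt (β * (j * (n / α))) ≤ J * c / (n * Real.log n) := by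
      refine (distInt_le_abs_sub_int _ (j * r.num)).trans ?_
      have e3 : β * (j * (n / α)) - ((j * r.num : ℤ) : ℝ) = j * n * (β / α - r) := by
        push_cast; rw [← hnum]; field_simp
      rw [e3, abs_mul, abs_of_nonneg (by positivity : (0 : ℝ) ≤ j * n)]
      calc _ ≤ J * n * (c / (n ^ 2 * Real.log n)) := by gcongr
        _ = _ := by field_simp
    rw [e1, distInt_nat, mul_zero, zero_add]
    calc _ ≤ 2 * Real.pi * (‖C‖ * (J * c / (n * Real.log n))) := by gcongr
      _ = _ := by rw [hD]; ring
  · have hNle : (N : ℝ) ≤ (J + 1 : ℕ) * (n / α) := by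
      have h1 : σ₀ ≤ n / α := by rw [le_div_iff₀ hα]; linarith
      have h2 : j * (n / α) ≤ J * (n / α) := by gcongr
      push_cast
      linarith [(abs_lt.1 hN).1]
    calc _ ≤ _ := lintegral_mono_set (Set.Icc_subset_Icc_right (by linarith))
      _ ≤ _ := setLIntegral_Icc_nat_mul_le (hint r (by exact_mod_cast hn3) happr1) (J + 1) x

theorem onlyZeroSolution_trig_of_approx {A B C : ℂ} {α β : ℝ} (hα : α ≠ 0) (hβ : β ≠ 0)
    (hαβ : α ≠ β) (h : ¬ (A = 0 ∧ B = 0 ∧ C = 0)) {c : ℝ}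
    (happ : ∀ n₀ : ℕ, ∃ r : ℚ, n₀ ≤ r.den ∧
      |β / α - r| * ((r.den : ℝ) ^ 2 * Real.log r.den) ≤ c) :
    OnlyZeroSolution fun ξ => ‖trig A B C α β ξ‖ := by
  rcases lt_or_gt_of_ne hα with h' | h'
  · have e : ∀ ξ, ‖trig A B C α β ξ‖ = ‖trig (starRingEnd ℂ A) (starRingEnd ℂ B)
        (starRingEnd ℂ C) (-α) (-β) ξ‖ := by
      intro ξ
      have := norm_trig_neg A B C (-α) (-β) ξ
      rwa [neg_neg, neg_neg] at this
    simp_rw [e]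
    refine onlyZeroSolution_trig_of_approx_of_pos (c := c) (by linarith) (neg_ne_zero.2 hβ)
      (fun h0 => hαβ (neg_injective h0)) (by simpa using h) ?_
    rwa [neg_div_neg_eq]
  · exact onlyZeroSolution_trig_of_approx_of_pos h' hβ hαβ h happ

/-- A quantitative form of Dirichlet's theorem, with arbitrarily large denominators. -/
theorem exists_ge_mul_distInt_le (θ : ℝ) (M : ℕ) : ∃ N ≥ M, 0 < N ∧ N * distInt (N * θ) ≤ 4 := by
  wlog hM : 0 < M generalizing M
  · obtain ⟨N, h1, h2⟩ := this 1 one_pos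
    exact ⟨N, by omega, h2⟩
  obtain ⟨k, hk0, hkM, hk⟩ := Real.exists_nat_abs_mul_sub_round_le θ (n := M ^ 2) (by positivity)
  have hMR : (0 : ℝ) < M := by exact_mod_cast hM
  have hMR1 : (1 : ℝ) ≤ M := by exact_mod_cast hM
  push_cast at hk
  rcases le_or_gt M k with h | h
  · refine ⟨k, h, hk0, ?_⟩
    have hkM' : (k : ℝ) ≤ (M : ℝ) ^ 2 := by exact_mod_cast hkM
    calc k * distInt (k * θ) ≤ (M : ℝ) ^ 2 * (1 / ((M : ℝ) ^ 2 + 1)) :=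
          mul_le_mul hkM' hk (distInt_nonneg _) (by positivity)
      _ ≤ 4 := by rw [mul_one_div, div_le_iff₀ (by positivity)]; nlinarith
  · set j := M / k + 1 with hj
    have h1 : M ≤ j * k := by
      have := Nat.lt_div_mul_add hk0 (a := M)
      rw [hj, add_mul, one_mul]; omega
    have h2 : j * k ≤ 2 * M := by
      have := Nat.div_mul_le_self M k
      rw [hj, add_mul, one_mul]; omega
    have h3 : j ≤ 2 * M := by
      have := Nat.div_le_self M k
      omega
    refine ⟨j * k, h1, by positivity, ?_⟩
    have h4 : distInt ((j * k : ℕ) * θ) ≤ j * (1 / ((M : ℝ) ^ 2 + 1)) := by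
      refine (distInt_le_abs_sub_int _ (j * round (k * θ))).trans ?_
      have e : ((j * k : ℕ) : ℝ) * θ - ((j * round (k * θ) : ℤ) : ℝ) =
          j * (k * θ - round (k * θ)) := by push_cast; ring
      rw [e, abs_mul, abs_of_nonneg (Nat.cast_nonneg j : (0 : ℝ) ≤ j)]
      gcongr
    have h2' : ((j * k : ℕ) : ℝ) ≤ 2 * M := by exact_mod_cast h2
    have h3' : (j : ℝ) ≤ 2 * M := by exact_mod_cast h3
    calc _ ≤ 2 * M * (2 * M * (1 / ((M : ℝ) ^ 2 + 1))) :=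
          mul_le_mul h2' (h4.trans (by gcongr)) (distInt_nonneg _) (by positivity)
      _ ≤ 4 := by
          rw [mul_one_div, ← mul_div_assoc, div_le_iff₀ (by positivity)]; nlinarith

theorem ae_norm_add_mul_expTurn_ne {A B : ℂ} (hA : A ≠ 0) (hB : B ≠ 0) {α : ℝ} (hα : α ≠ 0)
    (c : ℝ) : ∀ᵐ ξ : ℝ, ‖A + B * expTurn (α * ξ)‖ ≠ c := by
  have h := ae_trig_ne_zero (A := A * starRingEnd ℂ B) (B := (‖A‖ ^ 2 + ‖B‖ ^ 2 - c ^ 2 : ℝ))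
    (C := starRingEnd ℂ A * B) hα (mul_ne_zero two_ne_zero hα) (β := 2 * α)
    (fun h => hα (by linarith)) (by simp [hA, hB])
  filter_upwards [h] with ξ hξ heq
  apply hξ
  set e := expTurn (α * ξ) with he
  have h1 : (starRingEnd ℂ) e * e = 1 := by rw [he, conj_expTurn, expTurn_neg_mul]
  have h2 : expTurn (2 * α * ξ) = e * e := by rw [he, ← expTurn_add]; congr 1; ring
  have h3 : (A + B * e) * (starRingEnd ℂ) (A + B * e) = (c : ℂ) ^ 2 := by
    rw [Complex.mul_conj, Complex.normSq_eq_norm_sq, heq]; push_cast; ring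
  have hA2 : A * (starRingEnd ℂ) A = (‖A‖ : ℂ) ^ 2 := by
    rw [Complex.mul_conj, Complex.normSq_eq_norm_sq]; push_cast; ring
  have hB2 : B * (starRingEnd ℂ) B = (‖B‖ : ℂ) ^ 2 := by
    rw [Complex.mul_conj, Complex.normSq_eq_norm_sq]; push_cast; ring
  rw [map_add, map_mul] at h3
  rw [trig, h2, ← he]
  push_cast
  linear_combination e * h3 - e * hA2 - e * hB2 -
    (A * (starRingEnd ℂ) B + B * (starRingEnd ℂ) B * e) * h1

/-- Along an orbit of integer translations a trigonometric polynomial with rational frequency `α`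
is the sum of a function with finitely many values and a character, hence, for almost every
starting point, bounded below. -/
theorem exists_le_norm_trig_orbit {A B C : ℂ} {α β : ℝ} {q : ℕ} (hq : 0 < q) {m : ℤ}
    (hαq : α * q = m) {ξ : ℝ} (h : ∀ k : ℕ, ‖A + B * expTurn (α * (ξ - k))‖ ≠ ‖C‖) :
    ∃ c > 0, ∀ k : ℕ, c ≤ ‖trig A B C α β (ξ - k)‖ := by
  set v : ℕ → ℝ := fun k => |‖A + B * expTurn (α * (ξ - k))‖ - ‖C‖| with hv
  have hper : ∀ k, v k = v (k % q) := by
    intro k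
    have e : α * (ξ - k) = α * (ξ - (k % q : ℕ)) - ((m * (k / q : ℕ) : ℤ) : ℝ) := by
      have h1 : (k : ℝ) = (k % q : ℕ) + q * (k / q : ℕ) := by
        exact_mod_cast (Nat.mod_add_div k q).symm
      nth_rewrite 1 [h1]
      rw [Int.cast_mul, Int.cast_natCast, ← hαq]; ring
    simp only [hv]
    rw [e, expTurn_sub_int]
  obtain ⟨i, -, hi⟩ := (Finset.range q).exists_min_image v ⟨0, Finset.mem_range.2 hq⟩
  refine ⟨v i, abs_pos.2 (sub_ne_zero.2 (h i)), fun k => ?_⟩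
  calc v i ≤ v (k % q) := hi _ (Finset.mem_range.2 (Nat.mod_lt _ hq))
    _ = v k := (hper k).symm
    _ ≤ _ := by
      have h2 := abs_norm_sub_norm_le (A + B * expTurn (α * (ξ - k)))
        (-(C * expTurn (β * (ξ - k))))
      rwa [norm_neg, norm_mul, norm_expTurn, mul_one, sub_neg_eq_add] at h2

theorem onlyZeroSolution_trig_of_rational_of_ne_zero {A B C : ℂ} {α β : ℝ} (hα : α ≠ 0)
    (hA : A ≠ 0) (hB : B ≠ 0) {a : ℚ} (ha : (a : ℝ) = α) :
    OnlyZeroSolution fun ξ => ‖trig A B C α β ξ‖ := by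
  intro G hG hGm hG2 hrec
  set q := a.den with hq
  have hq0 : 0 < q := a.den_pos
  have hqR : (0 : ℝ) < q := by exact_mod_cast hq0
  have hαq : α * q = a.num := by rw [← ha]; exact_mod_cast a.mul_den_eq_num
  have hfm : Measurable fun x => ENNReal.ofReal (G x ^ 2) := by fun_prop
  have hrecadd : ∀ᵐ ξ : ℝ, ∀ n k : ℕ,
      G (ξ + n - k - 1) = ‖trig A B C α β (ξ + n - k)‖ * G (ξ + n - k) :=
    ae_all_iff.2 fun n =>
      (measurePreserving_add_right volume (n : ℝ)).quasiMeasurePreserving.ae (ae_orbit hrec)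
  filter_upwards [hrecadd, ae_orbit hrec, ae_orbit (ae_norm_add_mul_expTurn_ne hA hB hα ‖C‖),
    ae_tendsto_comp_add_nat hfm hG2, ae_tendsto_comp_sub_nat hfm hG2] with ξ hξn hξ hne hadd hsub
  obtain ⟨c, hc, hcP⟩ := exists_le_norm_trig_orbit (β := β) hq0 hαq hne
  set E := q * (8 * Real.pi * ‖C‖) / c with hE
  have hbound : ∀ η > 0, G ξ ^ 2 ≤ η * Real.exp E := by
    intro η hη
    have hη' : 0 < ENNReal.ofReal η := ENNReal.ofReal_pos.2 hη
    obtain ⟨k₀, hk₀⟩ := eventually_atTop.1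
      ((hadd.eventually_lt_const hη').and (hsub.eventually_lt_const hη'))
    obtain ⟨N, hN, hN0, hNd⟩ := exists_ge_mul_distInt_le (β * q) k₀
    have hNR : (0 : ℝ) < N := by exact_mod_cast hN0
    set n := q * N with hn
    have hnR : (n : ℝ) = q * N := by rw [hn]; push_cast; ring
    have hnk : k₀ ≤ n := hN.trans (Nat.le_mul_of_pos_left N hq0)
    obtain ⟨h1, h2⟩ := hk₀ n hnk
    rw [ENNReal.ofReal_lt_ofReal_iff hη] at h1 h2
    set δ := 2 * Real.pi * (‖C‖ * (4 / N)) with hδ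
    have hstep : ∀ x, ‖trig A B C α β (x + n)‖ ≤ ‖trig A B C α β x‖ + δ := by
      intro x
      refine (norm_trig_add_le A B C α β x n).trans (add_le_add le_rfl ?_)
      have e1 : α * n = ((a.num * N : ℤ) : ℝ) := by
        rw [hnR, ← mul_assoc, hαq]; push_cast; ring
      have e2 : β * n = N * (β * q) := by rw [hnR]; ring
      rw [e1, e2, distInt_int, mul_zero, zero_add, hδ]
      gcongr
      rwa [le_div_iff₀' hNR]
    have key := mul_le_mul_exp_sum_log (p := fun ξ => ‖trig A B C α β ξ‖) hG (T := n)
      (by positivity : 0 ≤ δ) (fun k => hc.trans_le (hcP k)) hξ (hξn n) n (fun k _ => hstep _)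
    rw [add_sub_cancel_right, ← sq] at key
    have hsum : ∑ k ∈ Finset.range n, Real.log (1 + δ / ‖trig A B C α β (ξ - k)‖) ≤ E := by
      calc _ ≤ ∑ k ∈ Finset.range n, δ / c := by
            refine Finset.sum_le_sum fun k _ => ?_
            refine (log_one_add_le_self (by positivity)).trans ?_
            gcongr
            exact hcP k
        _ = n * (δ / c) := by simp
        _ = E := by rw [hE, hδ, hnR]; field_simp; ring
    refine key.trans (mul_le_mul ?_ (Real.exp_le_exp.2 hsum) (Real.exp_pos _).le hη.le)
    nlinarith [sq_nonneg (G (ξ - n) - G (ξ + n))]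
  have h0 : G ξ ^ 2 ≤ 0 := by
    refine le_of_forall_pos_le_add fun ε hε => ?_
    have := hbound (ε / Real.exp E) (by positivity)
    rwa [div_mul_cancel₀ _ (Real.exp_pos _).ne', ← zero_add ε] at this
  exact pow_eq_zero_iff two_ne_zero |>.1 (le_antisymm h0 (sq_nonneg _))

theorem onlyZeroSolution_trig_of_rational {A B C : ℂ} {α β : ℝ} (hα : α ≠ 0) (hβ : β ≠ 0)
    (hαβ : α ≠ β) (h : ¬ (A = 0 ∧ B = 0 ∧ C = 0)) {a : ℚ} (ha : (a : ℝ) = α) :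
    OnlyZeroSolution fun ξ => ‖trig A B C α β ξ‖ := by
  have hβα : β - α ≠ 0 := sub_ne_zero.2 hαβ.symm
  by_cases hA : A = 0
  · -- dividing by a character makes `β - α` the only frequency
    have e : ∀ ξ, ‖trig A B C α β ξ‖ = ‖trig B C 0 (β - α) β ξ‖ := by
      intro ξ
      have h1 : trig A B C α β ξ = expTurn (α * ξ) * trig B C 0 (β - α) β ξ := by
        have h2 : expTurn (β * ξ) = expTurn (α * ξ) * expTurn ((β - α) * ξ) := by
          rw [← expTurn_add]; congr 1; ring
        simp only [trig, hA, h2]; ring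
      rw [h1, norm_mul, norm_expTurn, one_mul]
    simp_rw [e]
    refine onlyZeroSolution_trig_of_distInt_eq_zero hβα hβ (fun h0 => hα (by linarith))
      (fun h0 => h ⟨hA, h0.1, h0.2.1⟩) (T₀ := (1 : ℕ) / |β - α|)
      (div_pos (by simp) (abs_pos.2 hβα)) ?_ (by simp)
    rw [distInt_mul_div_abs hβα, mul_zero]
  by_cases hB : B = 0
  · refine onlyZeroSolution_trig_of_distInt_eq_zero hα hβ hαβ h (T₀ := (1 : ℕ) / |β|)
      (div_pos (by simp) (abs_pos.2 hβ)) (by simp [hB]) ?_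
    rw [distInt_mul_div_abs hβ, mul_zero]
  · exact onlyZeroSolution_trig_of_rational_of_ne_zero hα hA hB ha

/-! ### From the recurrence to linear independence -/

/-- The fractions `round (n ρ) / n` may be reduced: for irrational `ρ` their exact denominators
still tend to infinity, and the quality of approximation only improves. -/
theorem exists_rat_approx_of_frequently {ρ c : ℝ} (hρ : Irrational ρ)
    (h : ∃ᶠ n : ℕ in atTop, (n : ℝ) * Real.log n * distInt (n * ρ) < c) (n₀ : ℕ) :
    ∃ r : ℚ, n₀ ≤ r.den ∧ |ρ - r| * ((r.den : ℝ) ^ 2 * Real.log r.den) ≤ c := by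
  set Q : ℕ := n₀.factorial with hQ
  have hQ0 : Q ≠ 0 := Nat.factorial_ne_zero _
  have hQR : (0 : ℝ) < Q := by exact_mod_cast Nat.pos_of_ne_zero hQ0
  -- rationals whose denominator divides `Q` stay away from `ρ`
  have hd : 0 < distInt (Q * ρ) := by
    rw [distInt, abs_pos, sub_ne_zero]
    exact (hρ.natCast_mul hQ0).ne_int _
  obtain ⟨n₁, hn₁⟩ := exists_nat_gt (Q / distInt (Q * ρ))
  obtain ⟨n, hn, hnc⟩ := (frequently_atTop.1 h) (max n₁ 1)
  have hn1 : 1 ≤ n := (le_max_right _ _).trans hn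
  have hnR : (0 : ℝ) < n := by exact_mod_cast hn1
  have hnn₁ : (n₁ : ℝ) ≤ n := by exact_mod_cast (le_max_left _ _).trans hn
  set r : ℚ := (round (n * ρ) : ℚ) / n with hr
  have hrR : (r : ℝ) = round (n * ρ) / n := by rw [hr]; push_cast; rfl
  have hdist : n * |ρ - r| = distInt (n * ρ) := by
    rw [← abs_of_pos hnR, ← abs_mul, distInt, hrR, abs_of_pos hnR]
    congr 1
    field_simp
  have hden : r.den ∣ n := by
    have e : r = Rat.divInt (round (n * ρ)) n := by rw [hr, Rat.divInt_eq_div, Int.cast_natCast]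
    rw [e]
    exact_mod_cast Rat.den_dvd (round (n * ρ)) n
  have hdenle : r.den ≤ n := Nat.le_of_dvd hn1 hden
  refine ⟨r, ?_, ?_⟩
  · by_contra! hlt
    obtain ⟨k, hk⟩ := Nat.dvd_factorial r.den_pos hlt.le
    have hQr : (Q : ℝ) * r = ((k * r.num : ℤ) : ℝ) := by
      have h1 : (r : ℝ) * r.den = r.num := by exact_mod_cast r.mul_den_eq_num
      rw [hQ, hk]
      push_cast
      rw [← h1]; ring
    have h2 : distInt (Q * ρ) ≤ Q * |ρ - r| := by
      refine (distInt_le_abs_sub_int _ (k * r.num)).trans (le_of_eq ?_)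
      rw [← hQr, ← mul_sub, abs_mul, abs_of_pos hQR]
    have h3 : distInt (n * ρ) ≤ 1 := by
      rw [distInt]
      linarith [abs_sub_round ((n : ℝ) * ρ)]
    rw [div_lt_iff₀ hd] at hn₁
    have h4 : n * distInt (Q * ρ) ≤ Q := by
      calc _ ≤ n * (Q * |ρ - r|) := by gcongr
        _ = Q * distInt (n * ρ) := by rw [← hdist]; ring
        _ ≤ Q * 1 := by gcongr
        _ = Q := mul_one _
    nlinarith
  · have hdR : (r.den : ℝ) ≤ n := by exact_mod_cast hdenle
    have hd0 : (0 : ℝ) < r.den := by exact_mod_cast r.den_pos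
    calc _ ≤ |ρ - r| * ((n : ℝ) ^ 2 * Real.log n) := by
          have := Real.log_natCast_nonneg r.den
          gcongr
      _ = n * Real.log n * distInt (n * ρ) := by rw [← hdist]; ring
      _ ≤ c := hnc.le

theorem lintegral_norm_sq_ne_top (g : Lp ℂ 2 (volume : Measure ℝ)) :
    ∫⁻ x, ENNReal.ofReal (‖g x‖ ^ 2) ≠ ⊤ := by
  have h := (memLp_two_iff_integrable_sq_norm (Lp.aestronglyMeasurable g)).1 (Lp.memLp g)
  exact h.lintegral_lt_top.ne

/-- On the Fourier side a linear dependence becomes the recurrence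
`c₃ g(ξ - 1) = -P(ξ) g(ξ)` with the trigonometric polynomial `P` formed by the other
coefficients. -/
theorem ae_recurrence_of_dependence {α β : ℝ} {c₀ c₁ c₂ c₃ : ℂ} {f : Lp ℂ 2 (volume : Measure ℝ)}
    (h : c₀ • timeFreqShift (0, 0) f + c₁ • timeFreqShift (α, 0) f +
      c₂ • timeFreqShift (β, 0) f + c₃ • timeFreqShift (0, 1) f = 0) :
    ∀ᵐ ξ : ℝ, trig c₀ c₁ c₂ (-α) (-β) ξ * (𝓕 f : Lp ℂ 2 (volume : Measure ℝ)) ξ +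
      c₃ * (𝓕 f : Lp ℂ 2 (volume : Measure ℝ)) (ξ - 1) = 0 := by
  set g : Lp ℂ 2 (volume : Measure ℝ) := 𝓕 f with hg
  have h1 : c₀ • timeFreqShift (0, -0) g + c₁ • timeFreqShift (0, -α) g +
      c₂ • timeFreqShift (0, -β) g + c₃ • timeFreqShift (1, 0) g = 0 := by
    rw [hg, ← fourier_translate, ← fourier_translate, ← fourier_translate, ← fourier_modulate]
    have := congrArg (Lp.fourierTransformₗᵢ ℝ ℂ) h
    rw [map_add, map_add, map_add, map_smul, map_smul, map_smul, map_smul, map_zero] at this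
    exact this
  have h2 := Lp.coeFn_add (c₀ • timeFreqShift (0, -0) g + c₁ • timeFreqShift (0, -α) g +
      c₂ • timeFreqShift (0, -β) g) (c₃ • timeFreqShift (1, 0) g)
  rw [h1] at h2
  filter_upwards [h2, Lp.coeFn_zero ℂ 2 (volume : Measure ℝ),
    Lp.coeFn_add (c₀ • timeFreqShift (0, -0) g + c₁ • timeFreqShift (0, -α) g)
      (c₂ • timeFreqShift (0, -β) g),
    Lp.coeFn_add (c₀ • timeFreqShift (0, -0) g) (c₁ • timeFreqShift (0, -α) g),
    Lp.coeFn_smul c₀ (timeFreqShift (0, -0) g), Lp.coeFn_smul c₁ (timeFreqShift (0, -α) g),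
    Lp.coeFn_smul c₂ (timeFreqShift (0, -β) g), Lp.coeFn_smul c₃ (timeFreqShift (1, 0) g),
    coeFn_timeFreqShift (0, -0) g, coeFn_timeFreqShift (0, -α) g, coeFn_timeFreqShift (0, -β) g,
    coeFn_timeFreqShift (1, 0) g] with ξ e1 e2 e3 e4 e5 e6 e7 e8 e9 e10 e11 e12
  rw [e2, Pi.add_apply, e3, Pi.add_apply, e4, Pi.add_apply, e5, e6, e7, e8, Pi.smul_apply,
    Pi.smul_apply, Pi.smul_apply, Pi.smul_apply, e9, e10, e11, e12] at e1
  simp only [timeFreqTranslate, sub_zero, smul_eq_mul, Pi.zero_apply, neg_zero,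
    Complex.ofReal_zero, mul_zero, zero_mul, Complex.exp_zero, one_mul] at e1
  rw [e1]
  simp only [trig, expTurn]
  push_cast
  ring_nf

/-- The modulus of the Fourier transform solves the recurrence driven by `|P|`; conjugating the
coefficients of `P` turns its frequencies `-α, -β` into `α, β`. -/
theorem holdsFor_config_of_onlyZeroSolution {α β : ℝ} (hα : α ≠ 0) (hβ : β ≠ 0) (hαβ : α ≠ β)
    (H : ∀ A B C : ℂ, ¬ (A = 0 ∧ B = 0 ∧ C = 0) →
      OnlyZeroSolution fun ξ => ‖trig A B C α β ξ‖) : HoldsFor (config α β) := by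
  intro f hf
  set v : Fin 4 → ℝ × ℝ := ![(0, 0), (α, 0), (β, 0), (0, 1)] with hv
  have hinj : Function.Injective v := by
    intro i j hij
    fin_cases i <;> fin_cases j <;> simp_all [Prod.ext_iff, eq_comm]
  have hrange : config α β = Set.range v := by
    rw [config, hv]
    simp only [Matrix.range_cons, Matrix.range_empty, Set.union_empty, Set.singleton_union]
  rw [hrange, ← linearIndependent_equiv (Equiv.ofInjective v hinj), Fintype.linearIndependent_iff]
  intro c hc
  set g : Lp ℂ 2 (volume : Measure ℝ) := 𝓕 f with hg
  have hg0 : ¬ ∀ᵐ ξ : ℝ, g ξ = 0 := by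
    intro h0
    apply hf
    have : g = 0 := (Lp.eq_zero_iff_ae_eq_zero).2 h0
    exact (Lp.fourierTransformₗᵢ ℝ ℂ).map_eq_zero_iff.1 this
  have hrec := ae_recurrence_of_dependence (α := α) (β := β) (c₀ := c 0) (c₁ := c 1) (c₂ := c 2)
    (c₃ := c 3) (f := f) (by simpa [Fin.sum_univ_four, hv] using hc)
  rw [← hg] at hrec
  have hshift : ¬ ∀ᵐ ξ : ℝ, g (ξ - 1) = 0 := by
    intro h0
    refine hg0 ?_
    filter_upwards [(measurePreserving_add_right volume (1 : ℝ)).quasiMeasurePreserving.ae h0]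
      with ξ hξ
    simpa using hξ
  by_cases hz : c 0 = 0 ∧ c 1 = 0 ∧ c 2 = 0
  · have h3 : c 3 = 0 := by
      by_contra h3
      refine hshift ?_
      filter_upwards [hrec] with ξ hξ
      simpa [trig, hz, h3] using hξ
    intro i
    fin_cases i
    exacts [hz.1, hz.2.1, hz.2.2, h3]
  exfalso
  by_cases h3 : c 3 = 0
  · refine hg0 ?_
    filter_upwards [hrec, ae_trig_ne_zero (neg_ne_zero.2 hα) (neg_ne_zero.2 hβ)
      (fun h => hαβ (neg_injective h)) hz] with ξ hξ hne
    rw [h3, zero_mul, add_zero] at hξ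
    exact (mul_eq_zero.1 hξ).resolve_left hne
  have hG := H (starRingEnd ℂ (c 0 / c 3)) (starRingEnd ℂ (c 1 / c 3)) (starRingEnd ℂ (c 2 / c 3))
    (by simpa [h3] using hz) (fun ξ => ‖g ξ‖) (fun _ => norm_nonneg _)
    (Lp.stronglyMeasurable g).norm.measurable (lintegral_norm_sq_ne_top g) (by
      filter_upwards [hrec] with ξ hξ
      rw [← norm_trig_neg, ← norm_mul]
      have e : g (ξ - 1) = -(trig (c 0 / c 3) (c 1 / c 3) (c 2 / c 3) (-α) (-β) ξ * g ξ) := by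
        have e2 : trig (c 0) (c 1) (c 2) (-α) (-β) ξ =
            c 3 * trig (c 0 / c 3) (c 1 / c 3) (c 2 / c 3) (-α) (-β) ξ := by
          simp only [trig]; field_simp
        rw [e2] at hξ
        refine mul_left_cancel₀ h3 ?_
        linear_combination hξ
      rw [e, norm_neg])
  exact hg0 (hG.mono fun ξ hξ => norm_eq_zero.1 hξ)

theorem config_comm (α β : ℝ) : config α β = config β α := by
  rw [config, config, Set.insert_comm (α, 0) (β, 0)]

end HRT

end

theorem theorem2 (α β : ℝ) (hα : α ≠ 0) (hβ : β ≠ 0) (hαβ : α ≠ β) :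
    (Filter.liminf (fun n : ℕ =>
        (((n : ℝ) * Real.log n *
          min (HRT.distInt (n * (β / α))) (HRT.distInt (n * (α / β))) : ℝ) : EReal))
        Filter.atTop < ⊤ →
      HRT.HoldsFor (HRT.config α β)) ∧
    (α ∈ Set.range ((↑) : ℚ → ℝ) ∨ β ∈ Set.range ((↑) : ℚ → ℝ) →
      HRT.HoldsFor (HRT.config α β)) := by
  constructor
  · intro hlim
    by_cases hirr : Irrational (β / α)
    · have hirr' : Irrational (α / β) := by
        rw [← inv_div]
        exact irrational_inv_iff.2 hirr
      obtain ⟨c, hc, -⟩ := EReal.lt_iff_exists_real_btwn.1 hlim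
      have hfreq := (frequently_lt_of_liminf_lt (by isBoundedDefault) hc).mono
        fun n hn => EReal.coe_lt_coe_iff.1 hn
      have hor : ∃ᶠ n : ℕ in atTop, (n : ℝ) * Real.log n * HRT.distInt (n * (β / α)) < c ∨
          (n : ℝ) * Real.log n * HRT.distInt (n * (α / β)) < c := by
        refine hfreq.mono fun n hn => ?_
        rcases min_choice (HRT.distInt (n * (β / α))) (HRT.distInt (n * (α / β))) with h | h
        · rw [h] at hn; exact Or.inl hn
        · rw [h] at hn; exact Or.inr hn
      rcases frequently_or_distrib.1 hor with h | h
      · exact HRT.holdsFor_config_of_onlyZeroSolution hα hβ hαβ fun A B C hABC =>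
          HRT.onlyZeroSolution_trig_of_approx hα hβ hαβ hABC
            (HRT.exists_rat_approx_of_frequently hirr h)
      · rw [HRT.config_comm]
        exact HRT.holdsFor_config_of_onlyZeroSolution hβ hα hαβ.symm fun A B C hABC =>
          HRT.onlyZeroSolution_trig_of_approx hβ hα hαβ.symm hABC
            (HRT.exists_rat_approx_of_frequently hirr' h)
    · obtain ⟨r, hr⟩ := not_not.1 hirr
      exact HRT.holdsFor_config_of_onlyZeroSolution hα hβ hαβ fun A B C hABC =>
        HRT.onlyZeroSolution_trig_of_ratio_rational hα hβ hαβ hABC hr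
  · rintro (⟨a, ha⟩ | ⟨b, hb⟩)
    · exact HRT.holdsFor_config_of_onlyZeroSolution hα hβ hαβ fun A B C hABC =>
        HRT.onlyZeroSolution_trig_of_rational hα hβ hαβ hABC ha
    · rw [HRT.config_comm]
      exact HRT.holdsFor_config_of_onlyZeroSolution hβ hα hαβ.symm fun A B C hABC =>
        HRT.onlyZeroSolution_trig_of_rational hβ hα hαβ.symm hABC hb
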